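/- **Dual Stein lemma and dual Hoeffding bound.** Let $\mathscr E=\{E_1,\dots,E_m\}$ be a POVM (positive semidefinite operators with $\sum_k E_k=\mathbb 1$) on a $d$-dimensional Hilbert space $\mathscr H$, $1\le d<\infty$. The measurement is performed $n$ times, and the hypothesis $H_0$ is accepted if the sequence of outcomes $\mathbf k=(k_1,\dots,k_n)$ lies in a set $a\subseteq\{1,\dots,m\}^n$, and $H_1$ is accepted otherwise. Consider three families of protocols. * *General (block) inputs:* a density matrix $\rho^n$ (under $H_0$) or $\sigma^n$ (under $H_1$) on $\mathscr H^{\otimes n}$ is measured, with errors $\alpha_n=\operatorname{tr}(E^{\bar a}\rho^n)$ and $\beta_n=\operatorname{tr}(E^{a}\sigma^n)$, where $E^a=\sum_{\mathbf k\in a}E_{k_1}\otimes\cdots\otimes E_{k_n}$ and $\bar a$ is the complement of $a$. * *Adaptive inputs:* in step $s$ a density matrix $\rho_{k_1\dots k_{s-1}}$ (under $H_0$) or $\sigma_{k_1\dots k_{s-1}}$ (under $H_1$) on $\mathscr H$, which may depend on the previous outcomes, is prepared and measured; $\alpha_n=\sum_{\mathbf k\notin a}\prod_{s=1}^n\operatorname{tr}(E_{k_s}\rho_{k_1\dots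 k_{s-1}})$ and $\beta_n=\sum_{\mathbf k\in a}\prod_{s=1}^n\operatorname{tr}(E_{k_s}\sigma_{k_1\dots k_{s-1}})$. * *I.i.d. inputs from a pair $(\rho,\sigma)$ of density matrices on $\mathscr H$:* block inputs with $\rho^n=\rho^{\otimes n}$, $\sigma^n=\sigma^{\otimes n}$; only the sets $a$ vary. For a family of protocols and a constraint $\alpha_n\le c_n$, we say that $\zeta\in[-\infty,\infty]$ is the *optimal type-II exponent* if some sequence of protocols of the family (one for each $n$) that satisfies the constraint for every $n$ has $\lim_{n}-\frac1n\log\beta_n=\zeta$, and every such sequence has $\limsup_n-\frac1n\log\beta_n\le\zeta$ (with $-\log 0=+\infty$). For density matrices $\rho,\sigma$ on $\mathscr H$ put $P_k=\operatorname{tr}(E_k\rho)$, $\overline P_k=\operatorname{tr}(E_k\sigma)$, $D(P\|\overline P)=\sum_kP_k\log(P_k/\overline P_k)$ (equal to $+\infty$ if $P_k>0=\overline P_k$ for some $k$), and $\phi(s|P\|\overline P)=\log\sum_kP_k^s\overline P_k^{\,1-s}$ (with $0^0=1$ and $\log 0=-\infty$). 1. (Stein) Let $0<\epsilon<1$. The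 maximum $$\zeta_{\rm SL}=\max_{(\rho,\sigma)}D(P\|\overline P)\in[0,\infty]$$ exists, and it is the optimal type-II exponent under the constraint $\alpha_n\le\epsilon$, both for block inputs and for adaptive inputs, and also for i.i.d. inputs from any pair $(\rho,\sigma)$ that attains the maximum. 2. (Hoeffding) Let $r>0$, and suppose that $r$ is not the single critical rate given by $e^{-r}=\min_{(\rho,\sigma)}\sum_{k:\overline P_k>0}P_k$. The maximum $$\zeta_{\rm HB}=\max_{(\rho,\sigma)}\ \sup_{0\le s<1}\frac{-sr-\phi(s|P\|\overline P)}{1-s}\in[0,\infty]$$ exists, and it is the optimal type-II exponent under the constraint $\alpha_n\le e^{-nr}$, both for block inputs and for adaptive inputs, and also for i.i.d. inputs from any pair $(\rho,\sigma)$ that attains the maximum. -/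

import Mathlib

open Filter Topology
open scoped ComplexOrder

namespace DualDiscrimination

/-! ### States, measurements and tensor products -/

/-- A density matrix on the finite-dimensional Hilbert space with orthonormal basis `ι`. -/
structure DensityMatrix (ι : Type) [Fintype ι] where
  mat : Matrix ι ι ℂ
  posSemidef : mat.PosSemidef
  trace_eq_one : mat.trace = 1

/-- A POVM with outcomes `0, …, m - 1` on a `d`-dimensional Hilbert space. -/
structure POVM (d m : ℕ) where
  effect : Fin m → Matrix (Fin d) (Fin d) ℂ
  posSemidef : ∀ k, (effect k).PosSemidef
  sum_eq_one : ∑ k, effect k = 1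

/-- The tensor product `A 0 ⊗ ⋯ ⊗ A (n - 1)`, a matrix in the product basis of the `n`-fold tensor
power, whose elements are labelled by `Fin n → ι`. -/
def tensor {ι : Type} {n : ℕ} (A : Fin n → Matrix ι ι ℂ) :
    Matrix (Fin n → ι) (Fin n → ι) ℂ :=
  Matrix.of fun x y => ∏ i, A i (x i) (y i)

theorem tensor_mul {ι : Type} [Fintype ι] {n : ℕ} (A B : Fin n → Matrix ι ι ℂ) :
    tensor A * tensor B = tensor fun i => A i * B i := by
  classical
  ext x y
  simp only [tensor, Matrix.mul_apply, Matrix.of_apply, ← Finset.prod_mul_distrib]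
  rw [Finset.prod_univ_sum]
  simp

theorem tensor_conjTranspose {ι : Type} {n : ℕ} (A : Fin n → Matrix ι ι ℂ) :
    (tensor A).conjTranspose = tensor fun i => (A i).conjTranspose := by
  ext x y
  simp [tensor, Matrix.conjTranspose_apply]

theorem trace_tensor {ι : Type} [Fintype ι] {n : ℕ} (A : Fin n → Matrix ι ι ℂ) :
    (tensor A).trace = ∏ i, (A i).trace := by
  classical
  simp only [tensor, Matrix.trace, Matrix.diag_apply, Matrix.of_apply]
  rw [Finset.prod_univ_sum]
  simp

open scoped MatrixOrder Matrix.Norms.L2Operator in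
theorem posSemidef_tensor {ι : Type} [Fintype ι] {n : ℕ} {A : Fin n → Matrix ι ι ℂ}
    (hA : ∀ i, (A i).PosSemidef) : (tensor A).PosSemidef := by
  classical
  have h : ∀ i, ∃ B : Matrix ι ι ℂ, A i = B.conjTranspose * B := fun i =>
    CStarAlgebra.nonneg_iff_eq_star_mul_self.mp (hA i).nonneg
  choose B hB using h
  have : tensor A = (tensor B).conjTranspose * tensor B := by
    rw [tensor_conjTranspose, tensor_mul]
    congr 1
    funext i
    exact hB i
  rw [this]
  exact Matrix.posSemidef_conjTranspose_mul_self _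

/-- The i.i.d. state `ρ ⊗ ⋯ ⊗ ρ` of `n` copies. -/
def DensityMatrix.iid {ι : Type} [Fintype ι] (ρ : DensityMatrix ι) (n : ℕ) :
    DensityMatrix (Fin n → ι) where
  mat := tensor fun _ : Fin n => ρ.mat
  posSemidef := posSemidef_tensor fun _ => ρ.posSemidef
  trace_eq_one := by simp [trace_tensor, ρ.trace_eq_one]

namespace POVM

variable {d m : ℕ}

/-- The outcome distribution `k ↦ tr (E_k ρ)` of one measurement (a real number in `[0, 1]`). -/
noncomputable def prob (E : POVM d m) (ρ : DensityMatrix (Fin d)) (k : Fin m) : ℝ :=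
  (E.effect k * ρ.mat).trace.re

/-- The operator `E^a`: the sum over the outcome sequences `k` in `a` of
`E_{k_1} ⊗ ⋯ ⊗ E_{k_n}`. -/
noncomputable def grouped (E : POVM d m) {n : ℕ} (a : Finset (Fin n → Fin m)) :
    Matrix (Fin n → Fin d) (Fin n → Fin d) ℂ :=
  ∑ k ∈ a, tensor fun i => E.effect (k i)

/-- The pair `(α, β)` of type-I and type-II errors, `α = tr (E^{aᶜ} ρ)` and `β = tr (E^a σ)`, for a
pair of states of the `n`-copy system; the null hypothesis is accepted when the sequence of
outcomes lies in `a`. -/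
noncomputable def errors (E : POVM d m) {n : ℕ} (ρ σ : DensityMatrix (Fin n → Fin d))
    (a : Finset (Fin n → Fin m)) : ℝ × ℝ :=
  ((E.grouped aᶜ * ρ.mat).trace.re, (E.grouped a * σ.mat).trace.re)

/-- A preparation rule of an adaptive protocol with `n` measurements: the state sent in step `s`
is a function of the outcomes of the previous `s` measurements (steps are counted from `0`). -/
abbrev Preparation (d m n : ℕ) : Type :=
  (s : Fin n) → (Fin s → Fin m) → DensityMatrix (Fin d)

/-- The probability of the sequence `k` of outcomes under an adaptive preparation rule. -/
noncomputable def adaptiveProb (E : POVM d m) {n : ℕ} (τ : Preparation d m n)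
    (k : Fin n → Fin m) : ℝ :=
  ∏ s : Fin n, E.prob (τ s fun j => k ⟨j, j.isLt.trans s.isLt⟩) (k s)

/-- The pairs `(α, β)` of errors of `n` measurements on the i.i.d. pair built from `ρ` and `σ`,
over all groupings of the outcome sequences. -/
def iidErrors (E : POVM d m) (ρ σ : DensityMatrix (Fin d)) (n : ℕ) : Set (ℝ × ℝ) :=
  {e | ∃ a : Finset (Fin n → Fin m), e = E.errors (ρ.iid n) (σ.iid n) a}

/-- The pairs `(α, β)` of errors of `n` measurements, over all (possibly entangled) pairs of states
of the `n`-copy system and all groupings. -/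
def blockErrors (E : POVM d m) (n : ℕ) : Set (ℝ × ℝ) :=
  {e | ∃ (ρ σ : DensityMatrix (Fin n → Fin d)) (a : Finset (Fin n → Fin m)),
    e = E.errors ρ σ a}

/-- The pairs `(α, β)` of errors of `n` measurements, over all pairs of adaptive preparation rules
(one for each hypothesis) and all groupings. -/
def adaptiveErrors (E : POVM d m) (n : ℕ) : Set (ℝ × ℝ) :=
  {e | ∃ (τ υ : Preparation d m n) (a : Finset (Fin n → Fin m)),
    e = (∑ k ∈ aᶜ, E.adaptiveProb τ k, ∑ k ∈ a, E.adaptiveProb υ k)}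

end POVM

/-! ### Exponents -/

/-- `-(1/n) log β`, equal to `+∞` when `β = 0` (for `n ≥ 1`). -/
noncomputable def rate (n : ℕ) (β : ℝ) : EReal :=
  -(ENNReal.log (ENNReal.ofReal β) / ((n : ℝ) : EReal))

/-- Let `F n` be the set of pairs `(α, β)` of errors available with `n` measurements. The number
`ζ` is the optimal type-II exponent under the constraint `α_n ≤ c n`: it is the limit of
`-(1/n) log β_n` along some admissible sequence, and no admissible sequence does better, not even
in the sense of the limit superior. -/
def IsOptimalExponent (F : ℕ → Set (ℝ × ℝ)) (c : ℕ → ℝ) (ζ : EReal) : Prop :=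
  (∃ e : ℕ → ℝ × ℝ, (∀ n, e n ∈ F n ∧ (e n).1 ≤ c n) ∧
    Tendsto (fun n => rate n (e n).2) atTop (𝓝 ζ)) ∧
  ∀ e : ℕ → ℝ × ℝ, (∀ n, e n ∈ F n ∧ (e n).1 ≤ c n) →
    limsup (fun n => rate n (e n).2) atTop ≤ ζ

/-! ### Classical divergences of two distributions on a finite set -/

open Classical in
/-- The relative entropy `D(P‖Q) = ∑ P_k log (P_k / Q_k)`, equal to `+∞` if `P_k ≠ 0 = Q_k` for
some `k`. -/
noncomputable def relEntropy {m : ℕ} (P Q : Fin m → ℝ) : EReal :=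
  if ∀ k, Q k = 0 → P k = 0 then ((∑ k, P k * Real.log (P k / Q k) : ℝ) : EReal) else ⊤

/-- `φ(s|P‖Q) = log ∑ P_k^s Q_k^(1-s)`, equal to `-∞` if the sum vanishes. -/
noncomputable def phi {m : ℕ} (s : ℝ) (P Q : Fin m → ℝ) : EReal :=
  ENNReal.log (ENNReal.ofReal (∑ k, P k ^ s * Q k ^ (1 - s)))

/-- The Hoeffding function `sup_{0 ≤ s < 1} (-s r - φ(s|P‖Q)) / (1 - s)`. -/
noncomputable def hoeffding {m : ℕ} (r : ℝ) (P Q : Fin m → ℝ) : EReal :=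
  ⨆ s ∈ Set.Ico (0 : ℝ) 1, (((-(s * r) : ℝ) : EReal) - phi s P Q) / ((1 - s : ℝ) : EReal)

open Classical in
/-- The `P`-probability of the support of `Q`. -/
noncomputable def supportMass {m : ℕ} (P Q : Fin m → ℝ) : ℝ :=
  ∑ k with Q k ≠ 0, P k

end DualDiscrimination

/-! The upper bounds on the exponent are proved for adaptive protocols, the lower bounds for i.i.d.
inputs. Block inputs lie in between: conditioning a block state on earlier outcomes prepares the
next one-system state, so `POVM.exists_preparation` simulates it adaptively. One value from both
sides therefore settles all three families (`isOptimalExponent_of_subset`).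

Achievability is classical: likelihood ratio tests on i.i.d. outcomes, with errors bounded by powers
of the Hellinger sum.

The converse rests on a change of measure. If every conditional distribution R, relative to its
counterpart P, satisfies `moment t R P ≤ exp (t * B)`, these bounds multiply along the outcome
sequence whatever the adaptive rule, and a Markov argument gives R(a) ≤ e^{nx} P(a) + e^{-nt(x-B)}
(`sum_seqProd_le_exp_mul_add`). The derivative of the moment at t = 0 is the relative entropy, so B
may be any number above it; compactness of the set of outcome distributions provides one t for all
pairs. For Stein, R and P are the two actual distributions.

For Hoeffding, each pair (P, Q) is given an intermediate R with D(R‖P) < r and D(R‖Q) < B, where B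
exceeds the maximal Hoeffding value. These R are chosen step by step along the protocol. If both
errors were too small, the resulting measure would give vanishing mass to a and to its complement.
Such R exist on the geometric arc P^s Q^(1-s) (`exists_kl_lt_and_kl_lt`) when every support mass
exceeds e^{-r}. If some support mass is below e^{-r}, the Hoeffding function is infinite there and
no converse is needed; the excluded critical rate is the remaining case. -/

namespace DualDiscrimination

/-! ### Classical quantities on a finite set -/

section Classical

variable {ι : Type*} [Fintype ι]

/-- The real-valued relative entropy, meaningful when `Q k = 0` implies `P k = 0`. -/
noncomputable def kl (P Q : ι → ℝ) : ℝ := ∑ k, P k * Real.log (P k / Q k)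

/-- The moment of order `t` of the likelihood ratio `R / P` under `R`. -/
noncomputable def moment (t : ℝ) (R P : ι → ℝ) : ℝ := ∑ k, R k * (R k / P k) ^ t

/-- The Hellinger sum `∑ P_k^s Q_k^(1-s)`. -/
noncomputable def hellinger (s : ℝ) (P Q : ι → ℝ) : ℝ := ∑ k, P k ^ s * Q k ^ (1 - s)

theorem moment_nonneg {R P : ι → ℝ} (hR : ∀ k, 0 ≤ R k) (hP : ∀ k, 0 ≤ P k) (t : ℝ) :
    0 ≤ moment t R P :=
  Finset.sum_nonneg fun k _ => mul_nonneg (hR k) (Real.rpow_nonneg (div_nonneg (hR k) (hP k)) _)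

theorem hellinger_nonneg {P Q : ι → ℝ} (hP : ∀ k, 0 ≤ P k) (hQ : ∀ k, 0 ≤ Q k) (s : ℝ) :
    0 ≤ hellinger s P Q :=
  Finset.sum_nonneg fun k _ => mul_nonneg (Real.rpow_nonneg (hP k) _) (Real.rpow_nonneg (hQ k) _)

/-- A pointwise Markov inequality: either R is at most e^x P, or the ratio exceeds e^x and the
factor multiplying R in the second term is at least 1. The support hypothesis is essential, since R
/ 0 = 0 would hide an infinite ratio. -/
theorem le_exp_mul_add_moment {R P t : ℝ} (hR : 0 ≤ R) (hP : 0 ≤ P) (h : P = 0 → R = 0)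
    (ht : 0 < t) (x : ℝ) :
    R ≤ Real.exp x * P + R * (R / P) ^ t * Real.exp (-(t * x)) := by
  have h0 : 0 ≤ R * (R / P) ^ t * Real.exp (-(t * x)) := by positivity
  rcases le_or_gt R (Real.exp x * P) with h1 | h1
  · linarith
  · have hP' : 0 < P := by
      rcases hP.eq_or_lt with h2 | h2
      · have := h h2.symm
        rw [← h2, this] at h1
        simp at h1
      · exact h2
    have h2 : Real.exp x ≤ R / P := by rw [le_div_iff₀ hP']; exact h1.le
    have h3 : Real.exp (t * x) ≤ (R / P) ^ t := by
      rw [mul_comm, Real.exp_mul]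
      exact Real.rpow_le_rpow (Real.exp_pos x).le h2 ht.le
    have h4 : 1 ≤ (R / P) ^ t * Real.exp (-(t * x)) := by
      rw [Real.exp_neg, ← div_eq_mul_inv, one_le_div (Real.exp_pos _)]
      exact h3
    have h5 : R ≤ R * (R / P) ^ t * Real.exp (-(t * x)) := by
      rw [mul_assoc]
      exact le_mul_of_one_le_right hR h4
    have : 0 ≤ Real.exp x * P := by positivity
    linarith

theorem le_rpow_mul_rpow_of_le {a b s : ℝ} (ha : 0 ≤ a) (hab : a ≤ b) (hs : s ≤ 1) :
    a ≤ a ^ s * b ^ (1 - s) := by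
  rcases ha.eq_or_lt with h | h
  · rw [← h]
    have : 0 ≤ b := ha.trans hab
    positivity
  · calc a = a ^ s * a ^ (1 - s) := by rw [← Real.rpow_add h]; simp
      _ ≤ a ^ s * b ^ (1 - s) := by
        gcongr

/-- Power mean inequality for the weights R. It allows the order t to be decreased at fixed B, so
finitely many local orders can be replaced by their minimum. -/
theorem moment_le_exp_of_le {R P : ι → ℝ} (hR : R ∈ stdSimplex ℝ ι) (hP : ∀ k, 0 ≤ P k)
    {t u B : ℝ} (hu : 0 < u) (hut : u ≤ t) (h : moment t R P ≤ Real.exp (t * B)) :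
    moment u R P ≤ Real.exp (u * B) := by
  have ht : 0 < t := hu.trans_le hut
  have key := Real.rpow_arith_mean_le_arith_mean_rpow Finset.univ R (fun k => (R k / P k) ^ u)
    (fun k _ => hR.1 k) hR.2 (fun k _ => Real.rpow_nonneg (div_nonneg (hR.1 k) (hP k)) _)
    (p := t / u) ((one_le_div hu).2 hut)
  have h2 : ∀ k, ((R k / P k) ^ u) ^ (t / u) = (R k / P k) ^ t := fun k => by
    rw [← Real.rpow_mul (div_nonneg (hR.1 k) (hP k)), mul_div_cancel₀ _ hu.ne']
  simp only [h2] at key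
  have h3 : (moment u R P) ^ (t / u) ≤ (Real.exp (u * B)) ^ (t / u) := by
    refine key.trans (h.trans_eq ?_)
    rw [← Real.exp_mul]
    congr 1
    field_simp
  exact (Real.rpow_le_rpow_iff (moment_nonneg hR.1 hP u) (Real.exp_pos _).le (by positivity)).1 h3

theorem eventually_lt_of_hasDerivAt {f : ℝ → ℝ} {f' x : ℝ} (hf : HasDerivAt f f' x)
    (h : f' < 0) : ∀ᶠ y in 𝓝[>] x, f y < f x := by
  have h1 := (hasDerivAt_iff_tendsto_slope.1 hf).mono_left
    (nhdsWithin_mono x (fun y (hy : x < y) => hy.ne'))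
  filter_upwards [h1.eventually_lt_const h, self_mem_nhdsWithin] with y hy hxy
  rw [slope_def_field, div_neg_iff] at hy
  have : x < y := hxy
  rcases hy with hy | hy <;> linarith [hy.1, hy.2]

theorem hasDerivAt_moment {R P : ι → ℝ} (hR : ∀ k, 0 ≤ R k) (hP : ∀ k, 0 ≤ P k)
    (h : ∀ k, P k = 0 → R k = 0) : HasDerivAt (fun t => moment t R P) (kl R P) 0 := by
  unfold moment kl
  refine HasDerivAt.fun_sum fun k _ => ?_
  rcases (hR k).eq_or_lt with h0 | h0
  · simpa [← h0] using hasDerivAt_const (0 : ℝ) (0 : ℝ)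
  · have hPk : 0 < P k := (hP k).lt_of_ne' fun h1 => h0.ne' (h k h1)
    have := ((Real.hasStrictDerivAt_const_rpow (div_pos h0 hPk) 0).hasDerivAt).const_mul (R k)
    simpa using this

/-- Both sides equal 1 at t = 0, where their derivatives are `kl R P` and B. -/
theorem eventually_moment_lt_exp {R P : ι → ℝ} (hR : R ∈ stdSimplex ℝ ι) (hP : ∀ k, 0 ≤ P k)
    (h : ∀ k, P k = 0 → R k = 0) {B : ℝ} (hB : kl R P < B) :
    ∀ᶠ t in 𝓝[>] (0 : ℝ), moment t R P < Real.exp (t * B) := by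
  have h1 : HasDerivAt (fun t => Real.exp (t * B)) B 0 := by
    have := ((hasDerivAt_id (0 : ℝ)).mul_const B).exp
    simpa using this
  have h2 := (hasDerivAt_moment hR.1 hP h).sub h1
  filter_upwards [eventually_lt_of_hasDerivAt h2 (by linarith)] with t ht
  have h0 : moment 0 R P = 1 := by simpa [moment] using hR.2
  simp only [Pi.sub_apply, h0, zero_mul, Real.exp_zero, sub_self] at ht
  linarith

/-- The common support of `P` and `Q`. -/
noncomputable def commonSupport (P Q : ι → ℝ) : Finset ι :=
  open Classical in {k | P k ≠ 0 ∧ Q k ≠ 0}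

/-- The Hellinger sum over the common support. -/
noncomputable def arcSum (P Q : ι → ℝ) (s : ℝ) : ℝ :=
  ∑ k ∈ commonSupport P Q, Real.exp (s * Real.log (P k) + (1 - s) * Real.log (Q k))

/-- Only the open interval is allowed: at an endpoint the convention 0^0 = 1 adds mass off the
common support. `arcSum` is the continuous extension, used for limits s → 1. -/
theorem hellinger_eq_arcSum {P Q : ι → ℝ} (hP : ∀ k, 0 ≤ P k) (hQ : ∀ k, 0 ≤ Q k) {s : ℝ}
    (hs : 0 < s) (hs1 : s < 1) : hellinger s P Q = arcSum P Q s := by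
  classical
  unfold hellinger arcSum commonSupport
  rw [Finset.sum_filter]
  refine Finset.sum_congr rfl fun k _ => ?_
  rcases (hP k).eq_or_lt with h0 | h0
  · simp [← h0, Real.zero_rpow hs.ne']
  rcases (hQ k).eq_or_lt with h1 | h1
  · simp [← h1, Real.zero_rpow (sub_pos.2 hs1).ne']
  rw [if_pos ⟨h0.ne', h1.ne'⟩, Real.exp_add, Real.rpow_def_of_pos h0, Real.rpow_def_of_pos h1]
  congr 2 <;> ring

theorem continuous_arcSum (P Q : ι → ℝ) : Continuous (arcSum P Q) := by
  unfold arcSum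
  fun_prop

theorem arcSum_one {P : ι → ℝ} (hP : ∀ k, 0 ≤ P k) (Q : ι → ℝ) :
    arcSum P Q 1 = ∑ k ∈ commonSupport P Q, P k := by
  refine Finset.sum_congr rfl fun k hk => ?_
  have : 0 < P k := (hP k).lt_of_ne' (Finset.mem_filter.1 hk).2.1
  simp [Real.exp_log this]

theorem sum_commonSupport_lt {P Q : ι → ℝ} (hP : P ∈ stdSimplex ℝ ι) {k : ι} (hk : Q k = 0)
    (hPk : P k ≠ 0) : ∑ k ∈ commonSupport P Q, P k < 1 := by
  classical
  rw [← hP.2]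
  refine Finset.sum_lt_sum_of_subset (Finset.subset_univ _) (Finset.mem_univ k) ?_
    ((hP.1 k).lt_of_ne' hPk) fun j _ _ => hP.1 j
  simp [commonSupport, hk]

theorem hasDerivAt_arcSum_one {P Q : ι → ℝ} (hP : ∀ k, 0 ≤ P k)
    (h : ∀ k, Q k = 0 → P k = 0) : HasDerivAt (arcSum P Q) (kl P Q) 1 := by
  classical
  have h1 : kl P Q = ∑ k ∈ commonSupport P Q, P k * Real.log (P k / Q k) := by
    symm
    refine Finset.sum_subset (Finset.subset_univ _) fun k _ hk => ?_
    have : P k = 0 := by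
      by_contra h2
      exact hk (Finset.mem_filter.2 ⟨Finset.mem_univ k, h2, fun h3 => h2 (h k h3)⟩)
    simp [this]
  rw [h1]
  refine HasDerivAt.fun_sum fun k hk => ?_
  have hk' := (Finset.mem_filter.1 hk).2
  have hPk : 0 < P k := (hP k).lt_of_ne' hk'.1
  have h2 : HasDerivAt (fun s : ℝ => s * Real.log (P k) + (1 - s) * Real.log (Q k))
      (Real.log (P k) - Real.log (Q k)) 1 := by
    have := ((hasDerivAt_id (1 : ℝ)).mul_const (Real.log (P k))).add
      (((hasDerivAt_id (1 : ℝ)).const_sub 1).mul_const (Real.log (Q k)))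
    exact this.congr_deriv (by ring)
  have h3 := h2.exp
  rw [Real.log_div hPk.ne' hk'.2]
  simpa [Real.exp_log hPk] using h3

end Classical

/-! ### The geometric arc and the variational form of the Hoeffding function -/

section Duality

variable {ι : Type*} [Fintype ι]

/-- The normalised geometric mixture `P^s Q^(1-s)` on the common support. -/
noncomputable def arc (P Q : ι → ℝ) (s : ℝ) (k : ι) : ℝ :=
  open Classical in
  if k ∈ commonSupport P Q then
    Real.exp (s * Real.log (P k) + (1 - s) * Real.log (Q k)) / arcSum P Q s else 0

theorem arc_mem_stdSimplex {P Q : ι → ℝ} {s : ℝ} (h : 0 < arcSum P Q s) :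
    arc P Q s ∈ stdSimplex ℝ ι := by
  classical
  refine ⟨fun k => ?_, ?_⟩
  · unfold arc
    split_ifs <;> positivity
  · simp only [arc, Finset.sum_ite_mem, Finset.univ_inter]
    rw [← Finset.sum_div]
    exact div_self h.ne'

theorem arc_of_notMem {P Q : ι → ℝ} {k : ι} (hk : k ∉ commonSupport P Q) (s : ℝ) :
    arc P Q s k = 0 := if_neg hk

theorem arc_eq_zero_left {P Q : ι → ℝ} {k : ι} (hk : P k = 0) (s : ℝ) : arc P Q s k = 0 :=
  arc_of_notMem (by simp [commonSupport, hk]) s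

theorem arc_eq_zero_right {P Q : ι → ℝ} {k : ι} (hk : Q k = 0) (s : ℝ) : arc P Q s k = 0 :=
  arc_of_notMem (by simp [commonSupport, hk]) s

theorem log_arc_div {P Q A : ι → ℝ} {s : ℝ} (h : 0 < arcSum P Q s) {k : ι}
    (hk : k ∈ commonSupport P Q) (hA : A k ≠ 0) :
    Real.log (arc P Q s k / A k) =
      s * Real.log (P k) + (1 - s) * Real.log (Q k) - Real.log (arcSum P Q s) -
        Real.log (A k) := by
  rw [arc, if_pos hk, Real.log_div (by positivity) hA, Real.log_div (by positivity) h.ne',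
    Real.log_exp]

theorem kl_arc {P Q : ι → ℝ} {s : ℝ} (h : 0 < arcSum P Q s) (A : ι → ℝ)
    (hA : ∀ k ∈ commonSupport P Q, A k ≠ 0) :
    kl (arc P Q s) A = ∑ k ∈ commonSupport P Q,
      Real.exp (s * Real.log (P k) + (1 - s) * Real.log (Q k)) / arcSum P Q s *
      (s * Real.log (P k) + (1 - s) * Real.log (Q k) - Real.log (arcSum P Q s) -
        Real.log (A k)) := by
  classical
  have : kl (arc P Q s) A =
      ∑ k ∈ commonSupport P Q, arc P Q s k * Real.log (arc P Q s k / A k) := by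
    symm
    refine Finset.sum_subset (Finset.subset_univ _) fun k _ hk => ?_
    rw [arc_of_notMem hk, zero_mul]
  rw [this]
  refine Finset.sum_congr rfl fun k hk => ?_
  rw [log_arc_div h hk (hA k hk), arc, if_pos hk]

/-- On the arc, s log(R/P) + (1-s) log(R/Q) is the constant -log of the normalisation, and R has
total mass 1. -/
theorem kl_arc_combination {P Q : ι → ℝ} {s : ℝ} (h : 0 < arcSum P Q s) :
    s * kl (arc P Q s) P + (1 - s) * kl (arc P Q s) Q = -Real.log (arcSum P Q s) := by
  have hT : ∀ k ∈ commonSupport P Q, P k ≠ 0 ∧ Q k ≠ 0 := fun k hk => (Finset.mem_filter.1 hk).2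
  rw [kl_arc h P fun k hk => (hT k hk).1, kl_arc h Q fun k hk => (hT k hk).2, Finset.mul_sum,
    Finset.mul_sum, ← Finset.sum_add_distrib]
  have h1 : ∑ k ∈ commonSupport P Q,
      Real.exp (s * Real.log (P k) + (1 - s) * Real.log (Q k)) / arcSum P Q s = 1 := by
    rw [← Finset.sum_div]
    exact div_self h.ne'
  refine Eq.trans ?_ ((congrArg (· * -Real.log (arcSum P Q s)) h1).trans (one_mul _))
  rw [Finset.sum_mul]
  refine Finset.sum_congr rfl fun k _ => ?_
  ring

theorem kl_arc_one {P Q : ι → ℝ} (h : 0 < arcSum P Q 1) :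
    kl (arc P Q 1) P = -Real.log (arcSum P Q 1) := by
  simpa using kl_arc_combination h

theorem commonSupport_nonempty_of_arcSum_pos {P Q : ι → ℝ} {s : ℝ} (h : 0 < arcSum P Q s) :
    (commonSupport P Q).Nonempty := by
  by_contra h1
  rw [Finset.not_nonempty_iff_eq_empty] at h1
  simp [arcSum, h1] at h

theorem arcSum_pos {P Q : ι → ℝ} (h : (commonSupport P Q).Nonempty) (s : ℝ) :
    0 < arcSum P Q s :=
  Finset.sum_pos (fun _ _ => Real.exp_pos _) h

theorem continuous_kl_arc {P Q : ι → ℝ} (h : (commonSupport P Q).Nonempty) :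
    Continuous fun s => kl (arc P Q s) P := by
  have : (fun s => kl (arc P Q s) P) = fun s => ∑ k ∈ commonSupport P Q,
      Real.exp (s * Real.log (P k) + (1 - s) * Real.log (Q k)) / arcSum P Q s *
      (s * Real.log (P k) + (1 - s) * Real.log (Q k) - Real.log (arcSum P Q s) -
        Real.log (P k)) :=
    funext fun s => kl_arc (arcSum_pos h s) P fun k hk => (Finset.mem_filter.1 hk).2.1
  rw [this]
  have h1 := continuous_arcSum P Q
  have h2 : ∀ s, arcSum P Q s ≠ 0 := fun s => (arcSum_pos h s).ne'
  have h3 : Continuous fun s => Real.log (arcSum P Q s) := h1.log h2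
  refine continuous_finsetSum _ fun k _ => ?_
  exact ((by fun_prop : Continuous fun s : ℝ =>
    Real.exp (s * Real.log (P k) + (1 - s) * Real.log (Q k))).div h1 h2).mul (by fun_prop)

/-- The hard half of the duality. By `kl_arc_combination`, the bound on `arcSum` gives D(R_s‖Q) ≤ h
+ s(r - G(s))/(1-s) with G(s) = D(R_s‖P). A suitable s lies just to the right of the last point of
[0, 1] where s(r - G(s)) ≤ 0: there G(s) < r, while the bound is still below h'. Monotonicity of G
is not needed. -/
theorem exists_kl_lt_and_kl_lt {P Q : ι → ℝ} {r h h' : ℝ} (hr : Real.exp (-r) < arcSum P Q 1)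
    (hh : ∀ s, 0 < s → s < 1 → Real.exp (-(s * r) - h * (1 - s)) ≤ arcSum P Q s)
    (hh' : h < h') :
    ∃ R ∈ stdSimplex ℝ ι, (∀ k, P k = 0 → R k = 0) ∧ (∀ k, Q k = 0 → R k = 0) ∧
      kl R P < r ∧ kl R Q < h' := by
  have h1 : 0 < arcSum P Q 1 := (Real.exp_pos _).trans hr
  have hne := commonSupport_nonempty_of_arcSum_pos h1
  set G : ℝ → ℝ := fun s => kl (arc P Q s) P with hG
  have hGc : Continuous G := continuous_kl_arc hne
  have hG1 : G 1 < r := by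
    have : G 1 = -Real.log (arcSum P Q 1) := kl_arc_one h1
    have h2 := Real.log_lt_log (Real.exp_pos _) hr
    rw [Real.log_exp] at h2
    linarith
  -- The factor s puts 0 in K, so that K is nonempty even if G 0 < r.
  let K : Set ℝ := Set.Icc 0 1 ∩ {s | s * (r - G s) ≤ 0}
  have hK : IsCompact K :=
    isCompact_Icc.inter_right (isClosed_le (by fun_prop) continuous_const)
  obtain ⟨s₀, ⟨⟨hs0, hs1⟩, hs2⟩, hmax⟩ := hK.exists_isGreatest ⟨0, by simp [K]⟩
  have hs2' : s₀ * (r - G s₀) ≤ 0 := hs2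
  have hs1' : s₀ < 1 := by
    refine hs1.lt_of_ne fun h2 => ?_
    rw [h2] at hs2'
    linarith
  have hu : Tendsto (fun s => h + s * (r - G s) / (1 - s)) (𝓝[>] s₀)
      (𝓝 (h + s₀ * (r - G s₀) / (1 - s₀))) := by
    apply tendsto_nhdsWithin_of_tendsto_nhds
    have : ContinuousAt (fun s => h + s * (r - G s) / (1 - s)) s₀ := by
      refine continuousAt_const.add (ContinuousAt.div ?_ ?_ (by linarith))
      · exact (by fun_prop : Continuous fun s => s * (r - G s)).continuousAt
      · fun_prop
    exact this
  have hlt : h + s₀ * (r - G s₀) / (1 - s₀) < h' := by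
    have : s₀ * (r - G s₀) / (1 - s₀) ≤ 0 := div_nonpos_of_nonpos_of_nonneg hs2' (by linarith)
    linarith
  obtain ⟨s, hsu, hss⟩ := ((hu.eventually_lt_const hlt).and (Ioo_mem_nhdsGT hs1')).exists
  have hspos : 0 < s := hs0.trans_lt hss.1
  have hZ := arcSum_pos hne s
  have hGs : G s < r := by
    by_contra h2
    have : s ∈ K := ⟨⟨hspos.le, hss.2.le⟩,
      mul_nonpos_of_nonneg_of_nonpos hspos.le (by linarith)⟩
    exact (hmax this).not_gt hss.1
  refine ⟨arc P Q s, arc_mem_stdSimplex hZ, fun k hk => arc_eq_zero_left hk s,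
    fun k hk => arc_eq_zero_right hk s, hGs, lt_of_le_of_lt ?_ hsu⟩
  have h3 := kl_arc_combination hZ
  have h4 := (Real.le_log_iff_exp_le hZ).2 (hh s hspos hss.2)
  have h5 : 0 < 1 - s := by linarith [hss.2]
  have h6 : h + s * (r - G s) / (1 - s) = (h * (1 - s) + s * (r - G s)) / (1 - s) := by
    field_simp
  rw [h6, le_div_iff₀ h5]
  have h7 : s * kl (arc P Q s) P = s * G s := rfl
  nlinarith

/-- The easy half of the duality: Jensen's inequality for exp with weights R. -/
theorem exp_neg_kl_le_hellinger {P Q R : ι → ℝ} (hP : ∀ k, 0 ≤ P k) (hQ : ∀ k, 0 ≤ Q k)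
    (hR : R ∈ stdSimplex ℝ ι) (hRP : ∀ k, P k = 0 → R k = 0) (hRQ : ∀ k, Q k = 0 → R k = 0)
    (s : ℝ) : Real.exp (-(s * kl R P) - (1 - s) * kl R Q) ≤ hellinger s P Q := by
  have key := convexOn_exp.map_sum_le (t := Finset.univ) (w := R)
    (p := fun k => -(s * Real.log (R k / P k)) - (1 - s) * Real.log (R k / Q k))
    (fun k _ => hR.1 k) hR.2 (fun _ _ => Set.mem_univ _)
  simp only [smul_eq_mul] at key
  refine le_trans (le_of_eq ?_) (key.trans (Finset.sum_le_sum fun k _ => ?_))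
  · congr 1
    unfold kl
    rw [Finset.mul_sum, Finset.mul_sum, ← Finset.sum_neg_distrib, ← Finset.sum_sub_distrib]
    exact Finset.sum_congr rfl fun k _ => by ring
  · rcases (hR.1 k).eq_or_lt with h0 | h0
    · rw [← h0, zero_mul]
      exact mul_nonneg (Real.rpow_nonneg (hP k) _) (Real.rpow_nonneg (hQ k) _)
    · have hPk : 0 < P k := (hP k).lt_of_ne' fun h1 => h0.ne' (hRP k h1)
      have hQk : 0 < Q k := (hQ k).lt_of_ne' fun h1 => h0.ne' (hRQ k h1)
      rw [Real.rpow_def_of_pos hPk, Real.rpow_def_of_pos hQk, ← Real.exp_add]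
      nth_rewrite 1 [← Real.exp_log h0]
      rw [← Real.exp_add, Real.log_div h0.ne' hPk.ne', Real.log_div h0.ne' hQk.ne']
      apply le_of_eq
      congr 1
      ring

end Duality

/-! ### The Hoeffding function as a family of real inequalities -/

theorem hoeffding_term_le_iff {m : ℕ} {P Q : Fin m → ℝ} {r s h : ℝ} (hs : s < 1) :
    (((-(s * r) : ℝ) : EReal) - phi s P Q) / ((1 - s : ℝ) : EReal) ≤ h ↔
      Real.exp (-(s * r) - h * (1 - s)) ≤ hellinger s P Q := by
  have h1 : 0 < 1 - s := by linarith
  unfold phi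
  change (_ - ENNReal.log (ENNReal.ofReal (hellinger s P Q))) / _ ≤ _ ↔ _
  rcases le_or_gt (hellinger s P Q) 0 with h0 | h0
  · rw [ENNReal.ofReal_of_nonpos h0, ENNReal.log_zero, EReal.coe_sub_bot,
      EReal.top_div_of_pos_ne_top (by exact_mod_cast h1) (EReal.coe_ne_top _)]
    constructor
    · intro h2
      exact absurd h2 (by simp)
    · intro h2
      exact absurd (h2.trans h0) (Real.exp_pos _).not_ge
  · rw [ENNReal.log_ofReal_of_pos h0, ← EReal.coe_sub, ← EReal.coe_div, EReal.coe_le_coe_iff,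
      div_le_iff₀ h1, ← Real.le_log_iff_exp_le h0]
    constructor <;> intro h2 <;> linarith

theorem hoeffding_le_iff {m : ℕ} {P Q : Fin m → ℝ} {r h : ℝ} :
    hoeffding r P Q ≤ h ↔
      ∀ s, 0 ≤ s → s < 1 → Real.exp (-(s * r) - h * (1 - s)) ≤ hellinger s P Q := by
  unfold hoeffding
  rw [iSup₂_le_iff]
  exact forall_congr' fun s => ⟨fun h1 h2 h3 => (hoeffding_term_le_iff h3).1 (h1 ⟨h2, h3⟩),
    fun h1 h2 => (hoeffding_term_le_iff h2.2).2 (h1 h2.1 h2.2)⟩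

theorem supportMass_eq_arcSum {m : ℕ} {P : Fin m → ℝ} (hP : ∀ k, 0 ≤ P k) (Q : Fin m → ℝ) :
    supportMass P Q = arcSum P Q 1 := by
  classical
  rw [arcSum_one hP]
  unfold supportMass commonSupport
  rw [Finset.sum_filter, Finset.sum_filter]
  refine Finset.sum_congr rfl fun k _ => ?_
  by_cases h1 : P k = 0 <;> by_cases h2 : Q k = 0 <;> simp [h1, h2]

/-- As s → 1 the numerator tends to -r - log of the support mass, which is positive, while the
denominator 1 - s tends to 0. A finite bound y would give e^{-r} ≤ `supportMass P Q` in the limit.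
-/
theorem hoeffding_eq_top_of_supportMass_lt {m : ℕ} {P Q : Fin m → ℝ} (hP : ∀ k, 0 ≤ P k)
    (hQ : ∀ k, 0 ≤ Q k) {r : ℝ} (h : supportMass P Q < Real.exp (-r)) :
    hoeffding r P Q = ⊤ := by
  rw [EReal.eq_top_iff_forall_lt]
  intro y
  by_contra! hy
  have h1 := hoeffding_le_iff.1 hy
  rw [supportMass_eq_arcSum hP] at h
  have h2 : Tendsto (fun s : ℝ => Real.exp (-(s * r) - y * (1 - s))) (𝓝[<] 1)
      (𝓝 (Real.exp (-r))) := by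
    apply tendsto_nhdsWithin_of_tendsto_nhds
    have : Continuous fun s : ℝ => Real.exp (-(s * r) - y * (1 - s)) := by fun_prop
    simpa using this.tendsto 1
  have h3 : Tendsto (arcSum P Q) (𝓝[<] 1) (𝓝 (arcSum P Q 1)) :=
    tendsto_nhdsWithin_of_tendsto_nhds ((continuous_arcSum P Q).tendsto 1)
  refine h.not_ge (le_of_tendsto_of_tendsto h2 h3 ?_)
  filter_upwards [Ioo_mem_nhdsLT (zero_lt_one' ℝ)] with s hs
  rw [← hellinger_eq_arcSum hP hQ hs.1 hs.2]
  exact h1 s hs.1.le hs.2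

/-! ### Products of conditional weights along outcome sequences -/

section Sequences

variable {m : ℕ}

/-- The product of the weights of the successive outcomes of `k`, each weight depending on the
previous outcomes. -/
noncomputable def seqProd {n : ℕ} (g : (s : Fin n) → (Fin s → Fin m) → Fin m → ℝ)
    (k : Fin n → Fin m) : ℝ :=
  ∏ s : Fin n, g s (fun j => k ⟨j, j.isLt.trans s.isLt⟩) (k s)

theorem seqProd_snoc {n : ℕ} (g : (s : Fin (n + 1)) → (Fin s → Fin m) → Fin m → ℝ)
    (k : Fin n → Fin m) (x : Fin m) :
    seqProd g (Fin.snoc k x : Fin (n + 1) → Fin m) =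
      seqProd (fun s : Fin n => g s.castSucc) k * g (Fin.last n) k x := by
  unfold seqProd
  rw [Fin.prod_univ_castSucc]
  congr 1
  · refine Finset.prod_congr rfl fun s _ => ?_
    rw [Fin.snoc_castSucc]
    congr 1
    funext j
    exact Fin.snoc_castSucc (α := fun _ => Fin m) x k ⟨j, j.isLt.trans s.isLt⟩
  · rw [Fin.snoc_last]
    congr 1
    funext j
    exact Fin.snoc_castSucc (α := fun _ => Fin m) x k j

theorem sum_snoc {n : ℕ} (F : (Fin (n + 1) → Fin m) → ℝ) :
    ∑ k, F k = ∑ k : Fin n → Fin m, ∑ x, F (Fin.snoc k x : Fin (n + 1) → Fin m) := by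
  rw [← (Fin.snocEquiv fun _ : Fin (n + 1) => Fin m).sum_comp, Fintype.sum_prod_type_right]
  rfl

theorem sum_seqProd_le {n : ℕ} {g : (s : Fin n) → (Fin s → Fin m) → Fin m → ℝ}
    (hg : ∀ s h x, 0 ≤ g s h x) {C : ℝ} (hC0 : 0 ≤ C) (hC : ∀ s h, ∑ x, g s h x ≤ C) :
    ∑ k, seqProd g k ≤ C ^ n := by
  induction n with
  | zero => simp [seqProd]
  | succ n ih =>
    rw [sum_snoc, pow_succ]
    simp only [seqProd_snoc, ← Finset.mul_sum]
    calc _ ≤ ∑ k : Fin n → Fin m, seqProd (fun s : Fin n => g s.castSucc) k * C := by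
          refine Finset.sum_le_sum fun k _ => mul_le_mul_of_nonneg_left (hC _ _) ?_
          exact Finset.prod_nonneg fun s _ => hg _ _ _
      _ ≤ C ^ n * C := by
          rw [← Finset.sum_mul]
          exact mul_le_mul_of_nonneg_right (ih (fun s => hg s.castSucc) fun s => hC s.castSucc) hC0

theorem sum_seqProd_eq_one {n : ℕ} {g : (s : Fin n) → (Fin s → Fin m) → Fin m → ℝ}
    (hg : ∀ s h, ∑ x, g s h x = 1) : ∑ k, seqProd g k = 1 := by
  induction n with
  | zero => simp [seqProd]
  | succ n ih =>
    rw [sum_snoc]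
    simp only [seqProd_snoc, ← Finset.mul_sum, hg, mul_one]
    exact ih fun s => hg s.castSucc

/-- The joint likelihood ratio is the product of the conditional ones, so its moment of order t is
at most e^{ntB}, uniformly over the histories. `le_exp_mul_add_moment` at threshold n x is then
summed over a. -/
theorem sum_seqProd_le_exp_mul_add {n : ℕ} {R P : (s : Fin n) → (Fin s → Fin m) → Fin m → ℝ}
    (hR : ∀ s h x, 0 ≤ R s h x) (hP : ∀ s h x, 0 ≤ P s h x)
    (hRP : ∀ s h x, P s h x = 0 → R s h x = 0) {t B : ℝ} (ht : 0 < t)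
    (hB : ∀ s h, moment t (R s h) (P s h) ≤ Real.exp (t * B)) (x : ℝ)
    (a : Finset (Fin n → Fin m)) :
    ∑ k ∈ a, seqProd R k ≤
      Real.exp (n * x) * ∑ k ∈ a, seqProd P k + Real.exp (-(n * (t * (x - B)))) := by
  have hR' : ∀ k, 0 ≤ seqProd R k := fun k => Finset.prod_nonneg fun s _ => hR _ _ _
  have hP' : ∀ k, 0 ≤ seqProd P k := fun k => Finset.prod_nonneg fun s _ => hP _ _ _
  have h1 : ∀ k, seqProd R k * (seqProd R k / seqProd P k) ^ t =
      seqProd (fun s h x => R s h x * (R s h x / P s h x) ^ t) k := fun k => by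
    unfold seqProd
    rw [Finset.prod_mul_distrib, ← Finset.prod_div_distrib, Real.finsetProd_rpow]
    exact fun s _ => div_nonneg (hR _ _ _) (hP _ _ _)
  have h0 : ∀ s h x, 0 ≤ R s h x * (R s h x / P s h x) ^ t := fun s h x =>
    mul_nonneg (hR _ _ _) (Real.rpow_nonneg (div_nonneg (hR _ _ _) (hP _ _ _)) _)
  have h2 : ∑ k ∈ a, seqProd R k * (seqProd R k / seqProd P k) ^ t ≤ Real.exp (t * B) ^ n := by
    refine le_trans (Finset.sum_le_univ_sum_of_nonneg fun k => ?_) ?_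
    · exact mul_nonneg (hR' k) (Real.rpow_nonneg (div_nonneg (hR' k) (hP' k)) _)
    · simp only [h1]
      exact sum_seqProd_le h0 (Real.exp_pos _).le hB
  calc ∑ k ∈ a, seqProd R k
      ≤ ∑ k ∈ a, (Real.exp (n * x) * seqProd P k +
          seqProd R k * (seqProd R k / seqProd P k) ^ t * Real.exp (-(t * (n * x)))) := by
        refine Finset.sum_le_sum fun k _ => le_exp_mul_add_moment (hR' k) (hP' k) ?_ ht _
        intro hk
        obtain ⟨s, hs, hs'⟩ := Finset.prod_eq_zero_iff.1 hk
        exact Finset.prod_eq_zero hs (hRP _ _ _ hs')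
    _ = Real.exp (n * x) * ∑ k ∈ a, seqProd P k +
          (∑ k ∈ a, seqProd R k * (seqProd R k / seqProd P k) ^ t) *
            Real.exp (-(t * (n * x))) := by
        rw [Finset.sum_add_distrib, Finset.mul_sum, Finset.sum_mul]
    _ ≤ Real.exp (n * x) * ∑ k ∈ a, seqProd P k +
          Real.exp (t * B) ^ n * Real.exp (-(t * (n * x))) := by gcongr
    _ = _ := by
        rw [← Real.exp_nat_mul, ← Real.exp_add]
        congr 2
        ring

end Sequences

/-! ### The likelihood ratio test -/

section Test

variable {m : ℕ}

/-- The acceptance region of the likelihood ratio test with threshold `exp (n x)`. -/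
noncomputable def likelihoodTest (P Q : Fin m → ℝ) (n : ℕ) (x : ℝ) : Finset (Fin n → Fin m) :=
  open Classical in {k | Real.exp (n * x) * ∏ i, Q (k i) ≤ ∏ i, P (k i)}

theorem sum_prod_rpow_mul_rpow {P Q : Fin m → ℝ} (hP : ∀ k, 0 ≤ P k) (hQ : ∀ k, 0 ≤ Q k) (n : ℕ)
    (s : ℝ) : ∑ k : Fin n → Fin m, (∏ i, P (k i)) ^ s * (∏ i, Q (k i)) ^ (1 - s) =
      hellinger s P Q ^ n := by
  unfold hellinger
  rw [Fintype.sum_pow]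
  refine Finset.sum_congr rfl fun k _ => ?_
  rw [Finset.prod_mul_distrib, Real.finsetProd_rpow _ _ fun i _ => hP _,
    Real.finsetProd_rpow _ _ fun i _ => hQ _]

/-- Off the acceptance region p ≤ e^{nx} q, hence p ≤ p^s (e^{nx} q)^(1-s); the sum over all
sequences factorises. -/
theorem sum_compl_likelihoodTest_le {P Q : Fin m → ℝ} (hP : ∀ k, 0 ≤ P k) (hQ : ∀ k, 0 ≤ Q k)
    (n : ℕ) (x : ℝ) {s : ℝ} (hs : s ≤ 1) :
    ∑ k ∈ (likelihoodTest P Q n x)ᶜ, ∏ i, P (k i) ≤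
      (Real.exp (x * (1 - s)) * hellinger s P Q) ^ n := by
  classical
  have hP' : ∀ k : Fin n → Fin m, 0 ≤ ∏ i, P (k i) := fun k => Finset.prod_nonneg fun i _ => hP _
  have hQ' : ∀ k : Fin n → Fin m, 0 ≤ ∏ i, Q (k i) := fun k => Finset.prod_nonneg fun i _ => hQ _
  rw [mul_pow, ← sum_prod_rpow_mul_rpow hP hQ, Finset.mul_sum]
  have h0 : ∀ k : Fin n → Fin m, 0 ≤ Real.exp (x * (1 - s)) ^ n *
      ((∏ i, P (k i)) ^ s * (∏ i, Q (k i)) ^ (1 - s)) := fun k => by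
    have := hP' k
    have := hQ' k
    positivity
  refine le_trans (Finset.sum_le_sum fun k hk => ?_)
    (Finset.sum_le_univ_sum_of_nonneg (s := (likelihoodTest P Q n x)ᶜ) h0)
  have hk' : ∏ i, P (k i) ≤ Real.exp (n * x) * ∏ i, Q (k i) := by
    simp only [likelihoodTest, Finset.mem_compl, Finset.mem_filter, Finset.mem_univ, true_and,
      not_le] at hk
    exact hk.le
  refine (le_rpow_mul_rpow_of_le (hP' k) hk' hs).trans_eq ?_
  rw [Real.mul_rpow (Real.exp_pos _).le (hQ' k), ← Real.exp_mul, ← Real.exp_nat_mul]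
  ring_nf

theorem sum_likelihoodTest_le {P Q : Fin m → ℝ} (hP : ∀ k, 0 ≤ P k) (hQ : ∀ k, 0 ≤ Q k)
    (n : ℕ) (x : ℝ) {s : ℝ} (hs : 0 ≤ s) :
    ∑ k ∈ likelihoodTest P Q n x, ∏ i, Q (k i) ≤
      (Real.exp (-(x * s)) * hellinger s P Q) ^ n := by
  classical
  have hP' : ∀ k : Fin n → Fin m, 0 ≤ ∏ i, P (k i) := fun k => Finset.prod_nonneg fun i _ => hP _
  have hQ' : ∀ k : Fin n → Fin m, 0 ≤ ∏ i, Q (k i) := fun k => Finset.prod_nonneg fun i _ => hQ _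
  rw [mul_pow, ← sum_prod_rpow_mul_rpow hP hQ, Finset.mul_sum]
  have h0 : ∀ k : Fin n → Fin m, 0 ≤ Real.exp (-(x * s)) ^ n *
      ((∏ i, P (k i)) ^ s * (∏ i, Q (k i)) ^ (1 - s)) := fun k => by
    have := hP' k
    have := hQ' k
    positivity
  refine le_trans (Finset.sum_le_sum fun k hk => ?_)
    (Finset.sum_le_univ_sum_of_nonneg (s := likelihoodTest P Q n x) h0)
  have hk' : ∏ i, Q (k i) ≤ Real.exp (-(n * x)) * ∏ i, P (k i) := by
    simp only [likelihoodTest, Finset.mem_filter, Finset.mem_univ, true_and] at hk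
    rw [Real.exp_neg, inv_mul_eq_div, le_div_iff₀' (Real.exp_pos _)]
    exact hk
  have h1 := le_rpow_mul_rpow_of_le (s := 1 - s) (hQ' k) hk' (by linarith)
  refine h1.trans_eq ?_
  rw [sub_sub_cancel, Real.mul_rpow (Real.exp_pos _).le (hP' k), ← Real.exp_mul,
    ← Real.exp_nat_mul]
  ring_nf

theorem sum_likelihoodTest_le_exp {P Q : Fin m → ℝ} (hP : P ∈ stdSimplex ℝ (Fin m))
    (hQ : ∀ k, 0 ≤ Q k) (n : ℕ) (x : ℝ) :
    ∑ k ∈ likelihoodTest P Q n x, ∏ i, Q (k i) ≤ Real.exp (-(n * x)) := by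
  have h1 := sum_likelihoodTest_le hP.1 hQ n x zero_le_one
  have h2 : hellinger 1 P Q = 1 := by simpa [hellinger] using hP.2
  rw [h2, mul_one, mul_one, ← Real.exp_nat_mul] at h1
  exact h1.trans_eq (by ring_nf)

theorem exists_test_of_lt_hoeffding {P Q : Fin m → ℝ} (hP : ∀ k, 0 ≤ P k) (hQ : ∀ k, 0 ≤ Q k)
    {r y : ℝ} (h : (y : EReal) < hoeffding r P Q) (n : ℕ) :
    ∃ a : Finset (Fin n → Fin m), ∑ k ∈ aᶜ, ∏ i, P (k i) ≤ Real.exp (-(n * r)) ∧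
      ∑ k ∈ a, ∏ i, Q (k i) ≤ Real.exp (-(n * y)) := by
  have h1 : ¬ ∀ s, 0 ≤ s → s < 1 →
      Real.exp (-(s * r) - y * (1 - s)) ≤ hellinger s P Q := fun h2 =>
    h.not_ge (hoeffding_le_iff.2 h2)
  push Not at h1
  obtain ⟨s, hs0, hs1, hs⟩ := h1
  have hs2 : 0 < 1 - s := by linarith
  have hs3 : 0 ≤ hellinger s P Q := hellinger_nonneg hP hQ s
  -- The threshold making the type-I bound exactly e^{-nr}. It equals y - r, and the type-II bound
  -- then becomes e^{-ny}.
  set x := (s * r + y * (1 - s) - r) / (1 - s) with hx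
  have hx1 : x * (1 - s) = s * r + y * (1 - s) - r := div_mul_cancel₀ _ hs2.ne'
  refine ⟨likelihoodTest P Q n x, ?_, ?_⟩
  · refine (sum_compl_likelihoodTest_le hP hQ n x hs1.le).trans ?_
    rw [← mul_neg (n : ℝ), Real.exp_nat_mul]
    refine pow_le_pow_left₀ (by positivity) ?_ n
    refine (mul_le_mul_of_nonneg_left hs.le (Real.exp_pos _).le).trans_eq ?_
    rw [← Real.exp_add]
    congr 1
    linarith
  · refine (sum_likelihoodTest_le hP hQ n x hs0).trans ?_
    rw [← mul_neg (n : ℝ), Real.exp_nat_mul]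
    refine pow_le_pow_left₀ (by positivity) ?_ n
    refine (mul_le_mul_of_nonneg_left hs.le (Real.exp_pos _).le).trans_eq ?_
    rw [← Real.exp_add]
    congr 1
    have : x = y - r := by
      rw [hx, div_eq_iff hs2.ne']
      ring
    rw [this]
    ring

/-- If Q vanishes only where P does, the expression with `arcSum` equals 1 at s = 1 and has
derivative D(P‖Q) - y > 0 there, so it is below 1 just to the left. Otherwise it is already below 1
at s = 1, and continuity suffices. -/
theorem exists_exp_mul_hellinger_lt_one {P Q : Fin m → ℝ} (hP : P ∈ stdSimplex ℝ (Fin m))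
    (hQ : ∀ k, 0 ≤ Q k) {y : ℝ} (h : (y : EReal) < relEntropy P Q) :
    ∃ s, 0 < s ∧ s < 1 ∧ Real.exp (y * (1 - s)) * hellinger s P Q < 1 := by
  suffices h1 : ∀ᶠ s in 𝓝[<] (1 : ℝ), Real.exp (y * (1 - s)) * arcSum P Q s < 1 by
    obtain ⟨s, hs, hs'⟩ := (h1.and (Ioo_mem_nhdsLT (zero_lt_one' ℝ))).exists
    exact ⟨s, hs'.1, hs'.2, by rwa [hellinger_eq_arcSum hP.1 hQ hs'.1 hs'.2]⟩
  have hone : arcSum P Q 1 = ∑ k ∈ commonSupport P Q, P k := arcSum_one hP.1 Q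
  by_cases hPQ : ∀ k, Q k = 0 → P k = 0
  · rw [relEntropy, if_pos hPQ, EReal.coe_lt_coe_iff] at h
    have h1 : HasDerivAt (fun s : ℝ => Real.exp (y * (1 - s))) (-y) 1 := by
      have := (((hasDerivAt_id (1 : ℝ)).const_sub 1).const_mul y).exp
      simpa using this
    have h2 : arcSum P Q 1 = 1 := by
      classical
      rw [hone, ← hP.2]
      refine Finset.sum_subset (Finset.subset_univ _) fun k _ hk => ?_
      by_contra h3
      exact hk (Finset.mem_filter.2 ⟨Finset.mem_univ k, h3, fun h4 => h3 (hPQ k h4)⟩)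
    have h3 := (h1.mul (hasDerivAt_arcSum_one hP.1 hPQ))
    rw [h2] at h3
    have h4 : 0 < -y * 1 + Real.exp (y * (1 - 1)) * kl P Q := by
      simp only [sub_self, mul_zero, Real.exp_zero, one_mul, mul_one]
      have : y < kl P Q := h
      linarith
    have h5 := (hasDerivAt_iff_tendsto_slope.1 h3).mono_left
      (nhdsWithin_mono 1 (fun z (hz : z < 1) => hz.ne))
    filter_upwards [h5.eventually_const_lt h4, self_mem_nhdsWithin] with s hs hs1
    rw [slope_def_field, div_pos_iff] at hs
    have hs1' : s < 1 := hs1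
    simp only [Pi.mul_apply, h2, sub_self, mul_zero, Real.exp_zero, mul_one] at hs
    rcases hs with hs | hs <;> linarith [hs.1, hs.2]
  · push Not at hPQ
    obtain ⟨k, hk, hk'⟩ := hPQ
    have h1 := sum_commonSupport_lt hP hk hk'
    rw [← hone] at h1
    have h2 : Continuous fun s : ℝ => Real.exp (y * (1 - s)) * arcSum P Q s :=
      (by fun_prop : Continuous fun s : ℝ => Real.exp (y * (1 - s))).mul (continuous_arcSum P Q)
    have h3 := h2.tendsto 1
    simp only [sub_self, mul_zero, Real.exp_zero, one_mul] at h3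
    exact tendsto_nhdsWithin_of_tendsto_nhds h3 |>.eventually_lt_const h1

theorem eventually_exists_test_of_lt_relEntropy {P Q : Fin m → ℝ}
    (hP : P ∈ stdSimplex ℝ (Fin m)) (hQ : ∀ k, 0 ≤ Q k) {ε y : ℝ} (hε : 0 < ε)
    (h : (y : EReal) < relEntropy P Q) :
    ∀ᶠ n : ℕ in atTop, ∃ a : Finset (Fin n → Fin m), ∑ k ∈ aᶜ, ∏ i, P (k i) ≤ ε ∧
      ∑ k ∈ a, ∏ i, Q (k i) ≤ Real.exp (-(n * y)) := by
  obtain ⟨s, hs0, hs1, hs⟩ := exists_exp_mul_hellinger_lt_one hP hQ h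
  have h1 := tendsto_pow_atTop_nhds_zero_of_lt_one
    (mul_nonneg (Real.exp_pos _).le (hellinger_nonneg hP.1 hQ s)) hs
  filter_upwards [h1.eventually_lt_const hε] with n hn
  exact ⟨likelihoodTest P Q n y,
    (sum_compl_likelihoodTest_le hP.1 hQ n y hs1.le).trans hn.le,
    sum_likelihoodTest_le_exp hP hQ n y⟩

end Test

/-! ### Positive matrices and outcome distributions -/

section Quantum

open scoped MatrixOrder Matrix.Norms.L2Operator in
theorem exists_eq_conjTranspose_mul_self {ι : Type*} [Fintype ι] {A : Matrix ι ι ℂ}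
    (hA : A.PosSemidef) : ∃ B : Matrix ι ι ℂ, A = B.conjTranspose * B := by
  classical
  exact CStarAlgebra.nonneg_iff_eq_star_mul_self.mp hA.nonneg

theorem trace_mul_nonneg {ι : Type*} [Fintype ι] {A B : Matrix ι ι ℂ} (hA : A.PosSemidef)
    (hB : B.PosSemidef) : 0 ≤ (A * B).trace := by
  obtain ⟨C, rfl⟩ := exists_eq_conjTranspose_mul_self hA
  rw [Matrix.mul_assoc, Matrix.trace_mul_comm]
  exact (hB.mul_mul_conjTranspose_same C).trace_nonneg

variable {d m : ℕ}

theorem POVM.coe_prob (E : POVM d m) (ρ : DensityMatrix (Fin d)) (k : Fin m) :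
    ((E.prob ρ k : ℝ) : ℂ) = (E.effect k * ρ.mat).trace :=
  Complex.ext rfl (Complex.nonneg_iff.1 (trace_mul_nonneg (E.posSemidef k) ρ.posSemidef)).2

theorem POVM.prob_mem_stdSimplex (E : POVM d m) (ρ : DensityMatrix (Fin d)) :
    E.prob ρ ∈ stdSimplex ℝ (Fin m) := by
  refine ⟨fun k => (Complex.nonneg_iff.1
    (trace_mul_nonneg (E.posSemidef k) ρ.posSemidef)).1, ?_⟩
  unfold POVM.prob
  rw [← Complex.re_sum, ← Matrix.trace_sum, ← Finset.sum_mul, E.sum_eq_one, one_mul,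
    ρ.trace_eq_one, Complex.one_re]

theorem trace_tensor_mul_iid (E : POVM d m) (ρ : DensityMatrix (Fin d)) {n : ℕ}
    (k : Fin n → Fin m) :
    (tensor (fun i => E.effect (k i)) * (ρ.iid n).mat).trace = (∏ i, E.prob ρ (k i) : ℝ) := by
  rw [DensityMatrix.iid, tensor_mul, trace_tensor]
  push_cast
  exact Finset.prod_congr rfl fun i _ => (E.coe_prob ρ (k i)).symm

theorem POVM.trace_grouped_mul_re (E : POVM d m) {n : ℕ} (a : Finset (Fin n → Fin m))
    (ρ : Matrix (Fin n → Fin d) (Fin n → Fin d) ℂ) :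
    (E.grouped a * ρ).trace.re =
      ∑ k ∈ a, (tensor (fun i => E.effect (k i)) * ρ).trace.re := by
  rw [POVM.grouped, Finset.sum_mul, Matrix.trace_sum, Complex.re_sum]

theorem POVM.errors_iid (E : POVM d m) (ρ σ : DensityMatrix (Fin d)) {n : ℕ}
    (a : Finset (Fin n → Fin m)) :
    E.errors (ρ.iid n) (σ.iid n) a =
      (∑ k ∈ aᶜ, ∏ i, E.prob ρ (k i), ∑ k ∈ a, ∏ i, E.prob σ (k i)) := by
  unfold POVM.errors
  simp only [E.trace_grouped_mul_re, trace_tensor_mul_iid, Complex.ofReal_re]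

/-! ### Conditional states of a block input -/

theorem tensor_update_apply {ι : Type} {n : ℕ} (A : Fin n → Matrix ι ι ℂ) (i : Fin n)
    (X : Matrix ι ι ℂ) (x y : Fin n → ι) :
    tensor (Function.update A i X) x y =
      X (x i) (y i) * ∏ j ∈ Finset.univ.erase i, A j (x j) (y j) := by
  simp only [tensor, Matrix.of_apply]
  rw [← Finset.mul_prod_erase _ _ (Finset.mem_univ i), Function.update_self]
  congr 1
  refine Finset.prod_congr rfl fun j hj => ?_
  rw [Function.update_of_ne (Finset.ne_of_mem_erase hj)]

/-- The functional `X ↦ tr ((A_1 ⊗ ⋯ ⊗ X ⊗ ⋯ ⊗ A_n) ρ)`, with `X` in position `i`. -/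
noncomputable def slotFunctional {n : ℕ} (A : Fin n → Matrix (Fin d) (Fin d) ℂ) (i : Fin n)
    (ρ : Matrix (Fin n → Fin d) (Fin n → Fin d) ℂ) : Matrix (Fin d) (Fin d) ℂ →ₗ[ℂ] ℂ where
  toFun X := (tensor (Function.update A i X) * ρ).trace
  map_add' X Y := by
    rw [← Matrix.trace_add, ← add_mul]
    congr 2
    ext x y
    simp only [tensor_update_apply, Matrix.add_apply, add_mul]
  map_smul' c X := by
    rw [RingHom.id_apply, ← Matrix.trace_smul, ← smul_mul_assoc]
    congr 2
    ext x y
    simp only [tensor_update_apply, Matrix.smul_apply, smul_eq_mul, mul_assoc]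

theorem slotFunctional_nonneg {n : ℕ} {A : Fin n → Matrix (Fin d) (Fin d) ℂ}
    (hA : ∀ i, (A i).PosSemidef) (i : Fin n) {ρ : Matrix (Fin n → Fin d) (Fin n → Fin d) ℂ}
    (hρ : ρ.PosSemidef) {X : Matrix (Fin d) (Fin d) ℂ} (hX : X.PosSemidef) :
    0 ≤ slotFunctional A i ρ X := by
  refine trace_mul_nonneg (posSemidef_tensor fun j => ?_) hρ
  rcases eq_or_ne j i with rfl | h
  · rwa [Function.update_self]
  · rw [Function.update_of_ne h]
    exact hA j

theorem slotFunctional_conjTranspose {n : ℕ} {A : Fin n → Matrix (Fin d) (Fin d) ℂ}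
    (hA : ∀ i, (A i).PosSemidef) (i : Fin n) {ρ : Matrix (Fin n → Fin d) (Fin n → Fin d) ℂ}
    (hρ : ρ.PosSemidef) (X : Matrix (Fin d) (Fin d) ℂ) :
    slotFunctional A i ρ X.conjTranspose = star (slotFunctional A i ρ X) := by
  change (tensor (Function.update A i X.conjTranspose) * ρ).trace =
    star (tensor (Function.update A i X) * ρ).trace
  rw [← Matrix.trace_conjTranspose, Matrix.conjTranspose_mul, hρ.isHermitian.eq,
    Matrix.trace_mul_comm, tensor_conjTranspose]
  congr 3
  funext j
  rcases eq_or_ne j i with rfl | h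
  · simp
  · rw [Function.update_of_ne h, Function.update_of_ne h, (hA j).isHermitian.eq]

/-- M is read off from the values of L on matrix units; positivity of L on the rank-one matrices v
v* is positivity of the quadratic form of M. -/
theorem exists_posSemidef_trace_mul {L : Matrix (Fin d) (Fin d) ℂ →ₗ[ℂ] ℂ}
    (hL : ∀ X, X.PosSemidef → 0 ≤ L X) (hstar : ∀ X, L X.conjTranspose = star (L X)) :
    ∃ M : Matrix (Fin d) (Fin d) ℂ, M.PosSemidef ∧ ∀ X, L X = (X * M).trace := by
  let M : Matrix (Fin d) (Fin d) ℂ := Matrix.of fun a b => L (Matrix.single b a 1)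
  have hM : ∀ X, L X = (X * M).trace := fun X => by
    nth_rewrite 1 [Matrix.matrix_eq_sum_single X]
    simp only [Matrix.trace, Matrix.diag_apply, Matrix.mul_apply, map_sum, M, Matrix.of_apply]
    refine Finset.sum_congr rfl fun i _ => Finset.sum_congr rfl fun j _ => ?_
    rw [← smul_eq_mul, ← map_smul, Matrix.smul_single, smul_eq_mul, mul_one]
  refine ⟨M, Matrix.PosSemidef.of_dotProduct_mulVec_nonneg ?_ fun v => ?_, hM⟩
  · ext a b
    simp only [M, Matrix.conjTranspose_apply, Matrix.of_apply]
    rw [← hstar, Matrix.conjTranspose_single, star_one]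
  · have h := hL _ (Matrix.posSemidef_vecMulVec_self_star v)
    rw [hM] at h
    refine h.trans_eq ?_
    simp only [Matrix.trace, Matrix.diag_apply, Matrix.mul_apply, Matrix.vecMulVec_apply,
      dotProduct, Matrix.mulVec, Finset.mul_sum]
    rw [Finset.sum_comm]
    refine Finset.sum_congr rfl fun i _ => Finset.sum_congr rfl fun j _ => ?_
    ring

theorem nonempty_densityMatrix (hd : 0 < d) : Nonempty (DensityMatrix (Fin d)) := by
  refine ⟨⟨Matrix.diagonal (Pi.single ⟨0, hd⟩ 1), Matrix.PosSemidef.diagonal ?_, ?_⟩⟩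
  · exact Pi.single_nonneg.2 zero_le_one
  · simp [Matrix.trace_diagonal]

theorem exists_densityMatrix_trace_mul (hd : 0 < d) {L : Matrix (Fin d) (Fin d) ℂ →ₗ[ℂ] ℂ}
    (hL : ∀ X, X.PosSemidef → 0 ≤ L X) (hstar : ∀ X, L X.conjTranspose = star (L X)) :
    ∃ τ : DensityMatrix (Fin d), ∀ X, L X = L 1 * (X * τ.mat).trace := by
  obtain ⟨M, hM, hLM⟩ := exists_posSemidef_trace_mul hL hstar
  have h1 : L 1 = M.trace := by rw [hLM, one_mul]
  by_cases h0 : M.trace = 0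
  -- A history of probability zero: M = 0, and any state serves.
  · obtain ⟨τ⟩ := nonempty_densityMatrix hd
    refine ⟨τ, fun X => ?_⟩
    rw [h1, h0, zero_mul, hLM, hM.trace_eq_zero_iff.1 h0, mul_zero, Matrix.trace_zero]
  · refine ⟨⟨M.trace⁻¹ • M, hM.smul (inv_nonneg.2 hM.trace_nonneg), ?_⟩, fun X => ?_⟩
    · rw [Matrix.trace_smul, smul_eq_mul, inv_mul_cancel₀ h0]
    · rw [h1, hLM, Matrix.mul_smul, Matrix.trace_smul, smul_eq_mul, mul_inv_cancel_left₀ h0]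

/-- The effects of the first `s` outcomes, followed by identities. -/
noncomputable def POVM.prefixEffects (E : POVM d m) {n : ℕ} (s : ℕ) (h : Fin s → Fin m)
    (i : Fin n) : Matrix (Fin d) (Fin d) ℂ :=
  if hi : (i : ℕ) < s then E.effect (h ⟨i, hi⟩) else 1

theorem POVM.posSemidef_prefixEffects (E : POVM d m) {n : ℕ} (s : ℕ) (h : Fin s → Fin m)
    (i : Fin n) : (E.prefixEffects s h i).PosSemidef := by
  unfold POVM.prefixEffects
  split_ifs
  · exact E.posSemidef _
  · exact Matrix.PosSemidef.one

/-- The state for step s is the normalised conditional state of system s given the earlier outcomes,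
with later systems traced out. Prefix probabilities then satisfy the chain rule, and their product
telescopes. -/
theorem POVM.exists_preparation (hd : 0 < d) (E : POVM d m) {n : ℕ}
    (ρ : DensityMatrix (Fin n → Fin d)) :
    ∃ τ : Preparation d m n, ∀ k : Fin n → Fin m,
      (tensor (fun i => E.effect (k i)) * ρ.mat).trace.re = E.adaptiveProb τ k := by
  have hex : ∀ (s : Fin n) (h : Fin s → Fin m), ∃ τ : DensityMatrix (Fin d),
      ∀ X, slotFunctional (E.prefixEffects s h) s ρ.mat X =
        slotFunctional (E.prefixEffects s h) s ρ.mat 1 * (X * τ.mat).trace := fun s h =>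
    exists_densityMatrix_trace_mul hd
      (fun X hX => slotFunctional_nonneg (E.posSemidef_prefixEffects _ _) _ ρ.posSemidef hX)
      (fun X => slotFunctional_conjTranspose (E.posSemidef_prefixEffects _ _) _ ρ.posSemidef X)
  choose τ hτ using hex
  refine ⟨τ, fun k => ?_⟩
  let pre : ℕ → Fin n → Matrix (Fin d) (Fin d) ℂ := fun s i =>
    if (i : ℕ) < s then E.effect (k i) else 1
  let c : ℕ → ℂ := fun s => (tensor (pre s) * ρ.mat).trace
  let p : Fin n → ℝ := fun s => E.prob (τ s fun j => k ⟨j, j.isLt.trans s.isLt⟩) (k s)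
  have hpre : ∀ s : Fin n,
      E.prefixEffects (n := n) s (fun j => k ⟨j, j.isLt.trans s.isLt⟩) = pre s := fun s => by
    funext i
    simp only [POVM.prefixEffects, pre]
    split_ifs <;> rfl
  have hstep : ∀ s : Fin n, c (s + 1) = c s * (p s : ℂ) := fun s => by
    have h := hτ s (fun j => k ⟨j, j.isLt.trans s.isLt⟩) (E.effect (k s))
    rw [hpre] at h
    -- Slot s of the prefix already holds the identity, so the functional at 1 is the probability of
    -- the prefix.
    have h1 : Function.update (pre s) s 1 = pre s := by
      rw [Function.update_eq_self_iff]
      simp [pre]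
    have h2 : Function.update (pre s) s (E.effect (k s)) = pre (s + 1) := by
      funext i
      rcases eq_or_ne i s with rfl | hi
      · simp [pre]
      · rw [Function.update_of_ne hi]
        have : (i : ℕ) ≠ s := fun h => hi (Fin.ext h)
        have : (i : ℕ) < s ↔ (i : ℕ) < s + 1 := by omega
        simp only [pre, this]
    have h3 : (p s : ℂ) = _ := E.coe_prob _ _
    rw [h3]
    change (tensor (Function.update (pre s) s (E.effect (k s))) * ρ.mat).trace =
      (tensor (Function.update (pre s) s 1) * ρ.mat).trace * _ at h
    rw [h1, h2] at h
    exact h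
  have hprod : ∏ s : Fin n, (p s : ℂ) = c n := by
    let f : ℕ → ℂ := fun s => if h : s < n then (p ⟨s, h⟩ : ℂ) else 1
    have h1 : ∏ s : Fin n, (p s : ℂ) = ∏ s : Fin n, f s :=
      Finset.prod_congr rfl fun s _ => by simp [f]
    rw [h1, Fin.prod_univ_eq_prod_range f n]
    refine Finset.prod_range_induction _ _ ?_ _ fun s hs => ?_
    · have : pre 0 = fun _ => 1 := by
        funext i
        simp [pre]
      have h2 : tensor (fun _ : Fin n => (1 : Matrix (Fin d) (Fin d) ℂ)) = 1 := by
        ext x y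
        simp only [tensor, Matrix.of_apply, Matrix.one_apply, Finset.prod_ite_zero,
          Finset.prod_const_one, funext_iff, Finset.mem_univ, true_imp_iff]
      change (tensor (pre 0) * ρ.mat).trace = 1
      rw [this, h2, one_mul, ρ.trace_eq_one]
    · simpa [f, hs] using hstep ⟨s, hs⟩
  have hn : pre n = fun i => E.effect (k i) := by
    funext i
    simp [pre]
  rw [← hn]
  change (c n).re = _
  rw [← hprod, ← Complex.ofReal_prod, Complex.ofReal_re]
  rfl

/-! ### Inclusions between the families of protocols -/

theorem POVM.blockErrors_subset_adaptiveErrors (hd : 0 < d) (E : POVM d m) (n : ℕ) :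
    E.blockErrors n ⊆ E.adaptiveErrors n := by
  rintro e ⟨ρ, σ, a, rfl⟩
  obtain ⟨τ, hτ⟩ := E.exists_preparation hd ρ
  obtain ⟨υ, hυ⟩ := E.exists_preparation hd σ
  refine ⟨τ, υ, a, ?_⟩
  unfold POVM.errors
  simp only [E.trace_grouped_mul_re, hτ, hυ]

theorem POVM.iidErrors_subset_blockErrors (E : POVM d m) (ρ σ : DensityMatrix (Fin d)) (n : ℕ) :
    E.iidErrors ρ σ n ⊆ E.blockErrors n := by
  rintro e ⟨a, rfl⟩
  exact ⟨_, _, a, rfl⟩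

theorem POVM.iidErrors_finite (E : POVM d m) (ρ σ : DensityMatrix (Fin d)) (n : ℕ) :
    (E.iidErrors ρ σ n).Finite := by
  have : E.iidErrors ρ σ n = Set.range fun a => E.errors (ρ.iid n) (σ.iid n) a := by
    ext e
    exact exists_congr fun a => eq_comm
  rw [this]
  exact Set.finite_range _

/-! ### Compactness -/

/-- Density matrices are the B*B with B on the Hilbert–Schmidt unit sphere, which is compact;
outcome distributions depend continuously on B. -/
theorem POVM.isCompact_range_prob (E : POVM d m) : IsCompact (Set.range E.prob) := by
  let K : Set (Matrix (Fin d) (Fin d) ℂ) := {B | (B.conjTranspose * B).trace = 1}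
  have hKc : IsClosed K := isClosed_eq (by fun_prop) continuous_const
  have hbox : IsCompact (X := Matrix (Fin d) (Fin d) ℂ)
      (Set.univ.pi fun _ => Set.univ.pi fun _ => Metric.closedBall (0 : ℂ) 1) :=
    isCompact_univ_pi fun _ => isCompact_univ_pi fun _ => isCompact_closedBall _ _
  have hK : IsCompact K := by
    refine hbox.of_isClosed_subset hKc fun B (hB : _ = _) i _ j _ => ?_
    rw [mem_closedBall_zero_iff, ← abs_norm, ← sq_le_one_iff_abs_le_one]
    have h1 : ∑ j, ∑ i, ‖B i j‖ ^ 2 = 1 := by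
      have := congrArg Complex.re hB
      simp only [Matrix.trace, Matrix.diag_apply, Matrix.mul_apply, Matrix.conjTranspose_apply,
        Complex.re_sum, Complex.one_re] at this
      rw [← this]
      refine Finset.sum_congr rfl fun j _ => Finset.sum_congr rfl fun i _ => ?_
      rw [← Complex.normSq_eq_norm_sq, Complex.star_def, ← Complex.normSq_eq_conj_mul_self,
        Complex.ofReal_re]
    rw [← h1]
    refine (Finset.single_le_sum (f := fun i => ‖B i j‖ ^ 2) (fun i _ => sq_nonneg _)
      (Finset.mem_univ i)).trans ?_
    exact Finset.single_le_sum (f := fun j => ∑ i, ‖B i j‖ ^ 2)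
      (fun j _ => Finset.sum_nonneg fun i _ => sq_nonneg _) (Finset.mem_univ j)
  let f : Matrix (Fin d) (Fin d) ℂ → Fin m → ℝ := fun B k =>
    (E.effect k * (B.conjTranspose * B)).trace.re
  have hf : Continuous f := by fun_prop
  have : Set.range E.prob = f '' K := by
    ext P
    constructor
    · rintro ⟨ρ, rfl⟩
      obtain ⟨B, hB⟩ := exists_eq_conjTranspose_mul_self ρ.posSemidef
      refine ⟨B, ?_, ?_⟩
      · change (B.conjTranspose * B).trace = 1
        rw [← hB, ρ.trace_eq_one]
      · funext k
        change (E.effect k * (B.conjTranspose * B)).trace.re = _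
        rw [← hB]
        rfl
    · rintro ⟨B, hB, rfl⟩
      exact ⟨⟨_, Matrix.posSemidef_conjTranspose_mul_self B, hB⟩, rfl⟩
  rw [this]
  exact hK.image hf

end Quantum

/-! ### Exponents -/

section Exponents

theorem ennrealLog_ofReal_exp (x : ℝ) : ENNReal.log (ENNReal.ofReal (Real.exp x)) = x := by
  rw [ENNReal.log_ofReal_of_pos (Real.exp_pos x), Real.log_exp]

theorem rate_exp {n : ℕ} (hn : 0 < n) (y : ℝ) : rate n (Real.exp (-(n * y))) = y := by
  have : (n : ℝ) ≠ 0 := by positivity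
  rw [rate, ennrealLog_ofReal_exp, ← EReal.coe_div, ← EReal.coe_neg]
  congr 1
  field_simp

theorem rate_antitone (n : ℕ) : Antitone (rate n) := fun β γ h => by
  refine EReal.neg_le_neg_iff.2 (EReal.div_le_div_right_of_nonneg ?_ ?_)
  · exact_mod_cast n.cast_nonneg
  · exact ENNReal.log_le_log (ENNReal.ofReal_le_ofReal h)

theorem le_rate {n : ℕ} (hn : 0 < n) {y β : ℝ} (h : β ≤ Real.exp (-(n * y))) :
    (y : EReal) ≤ rate n β :=
  (rate_exp hn y).symm.trans_le (rate_antitone n h)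

theorem rate_le {n : ℕ} (hn : 0 < n) {y β : ℝ} (h : Real.exp (-(n * y)) ≤ β) :
    rate n β ≤ y :=
  (rate_antitone n h).trans_eq (rate_exp hn y)

/-- Since F n is finite, a protocol with least type-II error can be chosen for each n. This single
sequence attains every exponent below ζ, and the converse on the larger family G bounds it from
above. -/
theorem isOptimalExponent_of_subset {F G : ℕ → Set (ℝ × ℝ)} {c : ℕ → ℝ} {ζ : EReal}
    (hFG : ∀ n, F n ⊆ G n) (hfin : ∀ n, (F n).Finite) (hne : ∀ n, ∃ e ∈ F n, e.1 ≤ c n)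
    (hach : ∀ y : ℝ, (y : EReal) < ζ →
      ∀ᶠ n : ℕ in atTop, ∃ e ∈ F n, e.1 ≤ c n ∧ e.2 ≤ Real.exp (-(n * y)))
    (hconv : ∀ y : ℝ, ζ < y →
      ∀ᶠ n : ℕ in atTop, ∀ e ∈ G n, e.1 ≤ c n → Real.exp (-(n * y)) ≤ e.2) :
    IsOptimalExponent G c ζ := by
  have hmin : ∀ n, ∃ e ∈ {e ∈ F n | e.1 ≤ c n}, ∀ e' ∈ {e ∈ F n | e.1 ≤ c n}, e.2 ≤ e'.2 :=
    fun n => ((hfin n).subset (Set.sep_subset _ _)).exists_minimalFor Prod.snd _ (hne n) |>.imp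
      fun e he => ⟨he.1, fun e' he' => (le_total e.2 e'.2).elim id fun h => he.2 he' h⟩
  choose e he hle using hmin
  have hupper : ∀ f : ℕ → ℝ × ℝ, (∀ n, f n ∈ G n ∧ (f n).1 ≤ c n) → ∀ y : ℝ, ζ < y →
      ∀ᶠ n in atTop, rate n (f n).2 ≤ y := fun f hf y hy => by
    filter_upwards [hconv y hy, eventually_gt_atTop 0] with n hn hn0
    exact rate_le hn0 (hn _ (hf n).1 (hf n).2)
  refine ⟨⟨e, fun n => ⟨hFG n (he n).1, (he n).2⟩, tendsto_order.2 ⟨fun x hx => ?_, fun x hx => ?_⟩⟩,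
    fun f hf => ?_⟩
  · obtain ⟨y, hxy, hy⟩ := EReal.lt_iff_exists_real_btwn.1 hx
    filter_upwards [hach y hy, eventually_gt_atTop 0] with n ⟨e', he', h1, h2⟩ hn0
    exact hxy.trans_le (le_rate hn0 ((hle n e' ⟨he', h1⟩).trans h2))
  · obtain ⟨y, hy, hyx⟩ := EReal.lt_iff_exists_real_btwn.1 hx
    filter_upwards [hupper e (fun n => ⟨hFG n (he n).1, (he n).2⟩) y hy] with n hn
    exact hn.trans_lt hyx
  · refine le_of_forall_gt_imp_ge_of_dense fun x hx => ?_
    obtain ⟨y, hy, hyx⟩ := EReal.lt_iff_exists_real_btwn.1 hx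
    exact (limsup_le_of_le (by isBoundedDefault) (hupper f hf y hy)).trans hyx.le

theorem tendsto_exp_neg_natCast_mul {c : ℝ} (hc : 0 < c) :
    Tendsto (fun n : ℕ => Real.exp (-(n * c))) atTop (𝓝 0) :=
  Real.tendsto_exp_neg_atTop_nhds_zero.comp
    (tendsto_natCast_atTop_atTop.atTop_mul_const hc)

variable {d m : ℕ}

theorem POVM.isOptimalExponent_of_iid (hd : 0 < d) (E : POVM d m)
    {D : DensityMatrix (Fin d) → DensityMatrix (Fin d) → EReal} {c : ℕ → ℝ} {ζ : EReal}
    (hc : ∀ n, 0 ≤ c n) (hmax : ∃ ρ σ, D ρ σ = ζ)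
    (hach : ∀ ρ σ, ∀ y : ℝ, (y : EReal) < D ρ σ → ∀ᶠ n : ℕ in atTop,
      ∃ a : Finset (Fin n → Fin m), ∑ k ∈ aᶜ, ∏ i, E.prob ρ (k i) ≤ c n ∧
        ∑ k ∈ a, ∏ i, E.prob σ (k i) ≤ Real.exp (-(n * y)))
    (hconv : ∀ y : ℝ, ζ < y → ∀ᶠ n : ℕ in atTop,
      ∀ e ∈ E.adaptiveErrors n, e.1 ≤ c n → Real.exp (-(n * y)) ≤ e.2) :
    IsOptimalExponent E.blockErrors c ζ ∧ IsOptimalExponent E.adaptiveErrors c ζ ∧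
      ∀ ρ σ, D ρ σ = ζ → IsOptimalExponent (E.iidErrors ρ σ) c ζ := by
  have key : ∀ ρ σ, D ρ σ = ζ → ∀ G : ℕ → Set (ℝ × ℝ), (∀ n, E.iidErrors ρ σ n ⊆ G n) →
      (∀ n, G n ⊆ E.adaptiveErrors n) → IsOptimalExponent G c ζ := by
    intro ρ σ hρσ G hG hG'
    refine isOptimalExponent_of_subset hG (E.iidErrors_finite ρ σ)
      (fun n => ⟨_, ⟨Finset.univ, rfl⟩, ?_⟩) (fun y hy => ?_) (fun y hy => ?_)
    · simpa [E.errors_iid] using hc n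
    · filter_upwards [hach ρ σ y (hρσ ▸ hy)] with n ⟨a, h1, h2⟩
      refine ⟨_, ⟨a, rfl⟩, ?_⟩
      rw [E.errors_iid]
      exact ⟨h1, h2⟩
    · filter_upwards [hconv y hy] with n hn e he using hn e (hG' n he)
  have hib := E.iidErrors_subset_blockErrors
  have hba := E.blockErrors_subset_adaptiveErrors hd
  obtain ⟨ρ, σ, hρσ⟩ := hmax
  exact ⟨key ρ σ hρσ _ (hib ρ σ) hba,
    key ρ σ hρσ _ (fun n => (hib ρ σ n).trans (hba n)) fun n => subset_rfl,
    fun ρ σ h => key ρ σ h _ (fun n => subset_rfl) fun n => (hib ρ σ n).trans (hba n)⟩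

end Exponents

/-! ### Uniform moment bounds on compact sets of distributions -/

section Compactness

variable {ι : Type*} [Fintype ι]

theorem eventually_support_subset {R P : ι → ℝ} (h : ∀ k, P k = 0 → R k = 0) :
    ∀ᶠ P' in 𝓝 P, ∀ k, P' k = 0 → R k = 0 := by
  refine eventually_all.2 fun k => ?_
  by_cases hk : P k = 0
  · exact Eventually.of_forall fun _ _ => h k hk
  · filter_upwards [(continuous_apply k).continuousAt.eventually_ne hk] with P' h1 h2
    exact absurd h2 h1

theorem continuousAt_moment {R P : ι → ℝ} (h : ∀ k, P k = 0 → R k = 0) (t : ℝ) (ht : 0 ≤ t) :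
    ContinuousAt (fun P' => moment t R P') P := by
  refine tendsto_finsetSum _ fun k _ => ?_
  by_cases hk : P k = 0
  · simp only [h k hk, zero_mul]
    exact tendsto_const_nhds
  · exact ((continuousAt_const.div (continuous_apply k).continuousAt hk).rpow_const
      (Or.inr ht)).const_mul (R k)

theorem continuousAt_kl_right {R P : ι → ℝ} (h : ∀ k, P k = 0 → R k = 0) :
    ContinuousAt (fun P' => kl R P') P := by
  refine tendsto_finsetSum _ fun k _ => ?_
  by_cases hk : R k = 0
  · simp only [hk, zero_mul]
    exact tendsto_const_nhds
  · have hP : P k ≠ 0 := fun h1 => hk (h k h1)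
    exact ((continuousAt_const.div (continuous_apply k).continuousAt hP).log
      (div_ne_zero hk hP)).const_mul (R k)

/-- A zero of one Q in S is a zero of every P in S, so that coordinate contributes nothing on all of
S ×ˢ S. At the other coordinates the term is Q times x log x at x = P / Q, which is continuous even
at P = 0. -/
theorem continuousOn_kl {S : Set (ι → ℝ)}
    (hfin : ∀ P ∈ S, ∀ Q ∈ S, ∀ k, Q k = 0 → P k = 0) :
    ContinuousOn (fun x : (ι → ℝ) × (ι → ℝ) => kl x.1 x.2) (S ×ˢ S) := by
  rintro ⟨P, Q⟩ ⟨hP, hQ⟩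
  refine tendsto_finsetSum _ fun k _ => ?_
  by_cases hk : Q k = 0
  · refine ContinuousWithinAt.congr (continuousWithinAt_const (b := (0 : ℝ))) ?_ ?_
    · rintro ⟨P', Q'⟩ ⟨hP', hQ'⟩
      simp [hfin P' hP' Q hQ k hk]
    · simp [hfin P hP Q hQ k hk]
  · have h1 : ContinuousAt (fun x : (ι → ℝ) × (ι → ℝ) => x.1 k / x.2 k) (P, Q) :=
      ContinuousAt.div (by fun_prop) (by fun_prop) hk
    have h2 : ContinuousAt (fun x : (ι → ℝ) × (ι → ℝ) =>
        x.2 k * (x.1 k / x.2 k * Real.log (x.1 k / x.2 k))) (P, Q) :=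
      ContinuousAt.mul (by fun_prop)
        (Real.continuous_mul_log.continuousAt.comp (f := fun x : (ι → ℝ) × (ι → ℝ) =>
          x.1 k / x.2 k) h1)
    refine (h2.congr ?_).continuousWithinAt
    have h3 : ContinuousAt (fun x : (ι → ℝ) × (ι → ℝ) => x.2 k) (P, Q) := by fun_prop
    filter_upwards [h3.eventually_ne hk] with x hx
    rw [← mul_assoc, mul_div_cancel₀ _ hx]

theorem continuousOn_moment {S : Set (ι → ℝ)}
    (hfin : ∀ P ∈ S, ∀ Q ∈ S, ∀ k, Q k = 0 → P k = 0) {t : ℝ} (ht : 0 ≤ t) :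
    ContinuousOn (fun x : (ι → ℝ) × (ι → ℝ) => moment t x.1 x.2) (S ×ˢ S) := by
  rintro ⟨P, Q⟩ ⟨hP, hQ⟩
  refine tendsto_finsetSum _ fun k _ => ?_
  by_cases hk : Q k = 0
  · refine ContinuousWithinAt.congr (continuousWithinAt_const (b := (0 : ℝ))) ?_ ?_
    · rintro ⟨P', Q'⟩ ⟨hP', hQ'⟩
      simp [hfin P' hP' Q hQ k hk]
    · simp [hfin P hP Q hQ k hk]
  · have h1 : ContinuousAt (fun x : (ι → ℝ) × (ι → ℝ) => x.1 k / x.2 k) (P, Q) :=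
      ContinuousAt.div (by fun_prop) (by fun_prop) hk
    exact (ContinuousAt.mul (by fun_prop) (h1.rpow_const (Or.inr ht))).continuousWithinAt

/-- Each pair has its own order t, valid nearby by continuity of the moment; compactness leaves
finitely many, and their minimum works. -/
theorem exists_moment_le_exp {S : Set (ι → ℝ)} (hS : IsCompact S) (hsub : S ⊆ stdSimplex ℝ ι)
    (hfin : ∀ P ∈ S, ∀ Q ∈ S, ∀ k, Q k = 0 → P k = 0) {B : ℝ}
    (hB : ∀ P ∈ S, ∀ Q ∈ S, kl P Q < B) :
    ∃ t, 0 < t ∧ ∀ P ∈ S, ∀ Q ∈ S, moment t P Q ≤ Real.exp (t * B) := by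
  suffices h : ∃ t, 0 < t ∧ ∀ x ∈ S ×ˢ S, x ∈ S ×ˢ S → moment t x.1 x.2 ≤ Real.exp (t * B) by
    obtain ⟨t, ht, h⟩ := h
    exact ⟨t, ht, fun P hP Q hQ => h (P, Q) ⟨hP, hQ⟩ ⟨hP, hQ⟩⟩
  refine (hS.prod hS).induction_on (p := fun U => ∃ t, 0 < t ∧ ∀ x ∈ U, x ∈ S ×ˢ S →
    moment t x.1 x.2 ≤ Real.exp (t * B)) ⟨1, one_pos, by simp⟩ ?_ ?_ ?_
  · rintro U V hUV ⟨t, ht, h⟩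
    exact ⟨t, ht, fun x hx => h x (hUV hx)⟩
  · rintro U V ⟨t, ht, h⟩ ⟨u, hu, h'⟩
    refine ⟨min t u, lt_min ht hu, fun x hx hxS => ?_⟩
    rcases hx with hx | hx
    · exact moment_le_exp_of_le (hsub hxS.1) (hsub hxS.2).1 (lt_min ht hu) (min_le_left _ _)
        (h x hx hxS)
    · exact moment_le_exp_of_le (hsub hxS.1) (hsub hxS.2).1 (lt_min ht hu) (min_le_right _ _)
        (h' x hx hxS)
  · rintro ⟨P, Q⟩ ⟨hP, hQ⟩
    obtain ⟨t, ht, ht0⟩ := ((eventually_moment_lt_exp (hsub hP) (hsub hQ).1 (hfin P hP Q hQ)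
      (hB P hP Q hQ)).and self_mem_nhdsWithin).exists
    have ht0' : 0 < t := ht0
    have h1 := (continuousOn_moment hfin ht0'.le (P, Q) ⟨hP, hQ⟩).eventually_lt_const ht
    exact ⟨_, h1, t, ht0', fun x hx _ => le_of_lt hx⟩

/-- The R chosen for one pair also serves all nearby pairs, as the support conditions and strict
moment bounds are open in (P, Q) for fixed R. The uniform gap A' < A leaves room for a threshold
strictly below the type-I rate. -/
theorem exists_intermediate_moment_le_exp {S : Set (ι → ℝ)} (hS : IsCompact S)
    (hsub : S ⊆ stdSimplex ℝ ι) {A B : ℝ}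
    (h : ∀ P ∈ S, ∀ Q ∈ S, ∃ R ∈ stdSimplex ℝ ι, (∀ k, P k = 0 → R k = 0) ∧
      (∀ k, Q k = 0 → R k = 0) ∧ kl R P < A ∧ kl R Q < B) :
    ∃ t, 0 < t ∧ ∃ A' < A, ∀ P ∈ S, ∀ Q ∈ S, ∃ R ∈ stdSimplex ℝ ι,
      (∀ k, P k = 0 → R k = 0) ∧ (∀ k, Q k = 0 → R k = 0) ∧
      moment t R P ≤ Real.exp (t * A') ∧ moment t R Q ≤ Real.exp (t * B) := by
  let good : ℝ → ℝ → (ι → ℝ) × (ι → ℝ) → Prop := fun t A' x => ∃ R ∈ stdSimplex ℝ ι,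
    (∀ k, x.1 k = 0 → R k = 0) ∧ (∀ k, x.2 k = 0 → R k = 0) ∧
    moment t R x.1 ≤ Real.exp (t * A') ∧ moment t R x.2 ≤ Real.exp (t * B)
  have hgood : ∀ {t u A₁ A₂ : ℝ}, 0 < u → u ≤ t → A₁ ≤ A₂ → ∀ x ∈ S ×ˢ S, good t A₁ x →
      good u A₂ x := by
    rintro t u A₁ A₂ hu hut hA x hx ⟨R, hR, h1, h2, h3, h4⟩
    refine ⟨R, hR, h1, h2, (moment_le_exp_of_le hR (hsub hx.1).1 hu hut h3).trans ?_,
      moment_le_exp_of_le hR (hsub hx.2).1 hu hut h4⟩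
    gcongr
  suffices h : ∃ t, 0 < t ∧ ∃ A' < A, ∀ x ∈ S ×ˢ S, x ∈ S ×ˢ S → good t A' x by
    obtain ⟨t, ht, A', hA', h⟩ := h
    exact ⟨t, ht, A', hA', fun P hP Q hQ => h (P, Q) ⟨hP, hQ⟩ ⟨hP, hQ⟩⟩
  refine (hS.prod hS).induction_on (p := fun U => ∃ t, 0 < t ∧ ∃ A' < A, ∀ x ∈ U,
    x ∈ S ×ˢ S → good t A' x) ⟨1, one_pos, A - 1, by linarith, by simp⟩ ?_ ?_ ?_
  · rintro U V hUV ⟨t, ht, A', hA', h⟩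
    exact ⟨t, ht, A', hA', fun x hx => h x (hUV hx)⟩
  · rintro U V ⟨t, ht, A₁, hA₁, h⟩ ⟨u, hu, A₂, hA₂, h'⟩
    refine ⟨min t u, lt_min ht hu, max A₁ A₂, max_lt hA₁ hA₂, fun x hx hxS => ?_⟩
    rcases hx with hx | hx
    · exact hgood (lt_min ht hu) (min_le_left _ _) (le_max_left _ _) x hxS (h x hx hxS)
    · exact hgood (lt_min ht hu) (min_le_right _ _) (le_max_right _ _) x hxS (h' x hx hxS)
  · rintro ⟨P, Q⟩ ⟨hP, hQ⟩
    obtain ⟨R, hR, hRP, hRQ, hA, hB⟩ := h P hP Q hQ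
    obtain ⟨A', hA1, hA2⟩ := exists_between hA
    obtain ⟨t, ⟨ht1, ht2⟩, ht0⟩ := (((eventually_moment_lt_exp hR (hsub hP).1 hRP hA1).and
      (eventually_moment_lt_exp hR (hsub hQ).1 hRQ hB)).and self_mem_nhdsWithin).exists
    have ht0' : 0 < t := ht0
    have h1 := ((eventually_support_subset hRP).and
      ((continuousAt_moment hRP t ht0'.le).eventually_lt_const ht1)).prod_nhds
      ((eventually_support_subset hRQ).and
      ((continuousAt_moment hRQ t ht0'.le).eventually_lt_const ht2))
    exact ⟨_, mem_nhdsWithin_of_mem_nhds h1, t, ht0', A', hA2,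
      fun x hx _ => ⟨R, hR, hx.1.1, hx.2.1, hx.1.2.le, hx.2.2.le⟩⟩

end Compactness

/-! ### Maxima of the divergences -/

section Maxima

variable {m : ℕ}

theorem exists_isMaxOn_relEntropy {S : Set (Fin m → ℝ)} (hS : IsCompact S) (hne : S.Nonempty) :
    ∃ P ∈ S, ∃ Q ∈ S, ∀ P' ∈ S, ∀ Q' ∈ S, relEntropy P' Q' ≤ relEntropy P Q := by
  by_cases hfin : ∀ P ∈ S, ∀ Q ∈ S, ∀ k, Q k = 0 → P k = 0
  · obtain ⟨⟨P, Q⟩, ⟨hP, hQ⟩, hmax⟩ :=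
      (hS.prod hS).exists_isMaxOn (hne.prod hne) (continuousOn_kl hfin)
    refine ⟨P, hP, Q, hQ, fun P' hP' Q' hQ' => ?_⟩
    rw [relEntropy, relEntropy, if_pos (hfin P' hP' Q' hQ'), if_pos (hfin P hP Q hQ),
      EReal.coe_le_coe_iff]
    exact hmax (Set.mk_mem_prod hP' hQ')
  · push Not at hfin
    obtain ⟨P, hP, Q, hQ, k, hk, hk'⟩ := hfin
    refine ⟨P, hP, Q, hQ, fun P' _ Q' _ => ?_⟩
    have : relEntropy P Q = ⊤ := if_neg fun h => hk' (h k hk)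
    rw [this]
    exact le_top

theorem exists_kl_lt_of_hoeffding_le {P Q : Fin m → ℝ} (hP : ∀ k, 0 ≤ P k) (hQ : ∀ k, 0 ≤ Q k)
    {r h h' : ℝ} (hr : Real.exp (-r) < supportMass P Q) (hh : hoeffding r P Q ≤ h)
    (hh' : h < h') :
    ∃ R ∈ stdSimplex ℝ (Fin m), (∀ k, P k = 0 → R k = 0) ∧ (∀ k, Q k = 0 → R k = 0) ∧
      kl R P < r ∧ kl R Q < h' := by
  rw [supportMass_eq_arcSum hP] at hr
  refine exists_kl_lt_and_kl_lt hr (fun s hs0 hs1 => ?_) hh'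
  rw [← hellinger_eq_arcSum hP hQ hs0 hs1]
  exact hoeffding_le_iff.1 hh s hs0.le hs1

theorem hoeffding_le_of_kl_le {P Q R : Fin m → ℝ} (hP : ∀ k, 0 ≤ P k) (hQ : ∀ k, 0 ≤ Q k)
    (hR : R ∈ stdSimplex ℝ (Fin m)) (hRP : ∀ k, P k = 0 → R k = 0)
    (hRQ : ∀ k, Q k = 0 → R k = 0) {r h : ℝ} (hr : kl R P ≤ r) (hh : kl R Q ≤ h) :
    hoeffding r P Q ≤ h := by
  refine hoeffding_le_iff.2 fun s hs0 hs1 =>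
    le_trans (Real.exp_le_exp.2 ?_) (exp_neg_kl_le_hellinger hP hQ hR hRP hRQ s)
  have h1 := mul_le_mul_of_nonneg_left hr hs0
  have h2 := mul_le_mul_of_nonneg_left hh (by linarith : 0 ≤ 1 - s)
  linarith

/-- An intermediate R witnessing a bound at one pair remains a witness at nearby pairs, by
continuity of `kl R` and the easy half of the duality. -/
theorem upperSemicontinuousOn_hoeffding {S : Set (Fin m → ℝ)}
    (hsub : S ⊆ stdSimplex ℝ (Fin m)) {r : ℝ}
    (hr : ∀ P ∈ S, ∀ Q ∈ S, Real.exp (-r) < supportMass P Q) :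
    UpperSemicontinuousOn (fun x : (Fin m → ℝ) × (Fin m → ℝ) => hoeffding r x.1 x.2)
      (S ×ˢ S) := by
  rintro ⟨P, Q⟩ ⟨hP, hQ⟩ y hy
  obtain ⟨h', hh1, hh2⟩ := EReal.lt_iff_exists_real_btwn.1 hy
  obtain ⟨h, hh3, hh4⟩ := EReal.lt_iff_exists_real_btwn.1 hh1
  obtain ⟨R, hR, hRP, hRQ, hA, hB⟩ := exists_kl_lt_of_hoeffding_le (hsub hP).1 (hsub hQ).1
    (hr P hP Q hQ) hh3.le (EReal.coe_lt_coe_iff.1 hh4)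
  have h1 := ((eventually_support_subset hRP).and
    ((continuousAt_kl_right hRP).eventually_lt_const hA)).prod_nhds
    ((eventually_support_subset hRQ).and
    ((continuousAt_kl_right hRQ).eventually_lt_const hB))
  filter_upwards [mem_nhdsWithin_of_mem_nhds h1, self_mem_nhdsWithin] with x hx hxS
  exact (hoeffding_le_of_kl_le (hsub hxS.1).1 (hsub hxS.2).1 hR hx.1.1 hx.2.1 hx.1.2.le
    hx.2.2.le).trans_lt hh2

end Maxima

/-! ### Converse bounds for adaptive protocols -/

section Converse

variable {d m : ℕ}

theorem eventually_le_of_relEntropy_le (E : POVM d m) {ε : ℝ} (hε : ε < 1) {ζ : EReal}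
    (hζ : ∀ ρ σ, relEntropy (E.prob ρ) (E.prob σ) ≤ ζ) {y : ℝ} (hy : ζ < y) :
    ∀ᶠ n : ℕ in atTop, ∀ e ∈ E.adaptiveErrors n, e.1 ≤ ε → Real.exp (-(n * y)) ≤ e.2 := by
  obtain ⟨x, hx1, hx2⟩ := EReal.lt_iff_exists_real_btwn.1 hy
  obtain ⟨B, hB1, hB2⟩ := EReal.lt_iff_exists_real_btwn.1 hx1
  rw [EReal.coe_lt_coe_iff] at hx2 hB2
  have hfin : ∀ ρ σ, (∀ k, E.prob σ k = 0 → E.prob ρ k = 0) ∧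
      kl (E.prob ρ) (E.prob σ) < B := fun ρ σ => by
    have h1 := (hζ ρ σ).trans_lt hB1
    unfold relEntropy at h1
    split_ifs at h1 with h2
    · exact ⟨h2, EReal.coe_lt_coe_iff.1 h1⟩
    · exact absurd h1 not_top_lt
  obtain ⟨t, ht, hmom⟩ := exists_moment_le_exp E.isCompact_range_prob
    (Set.range_subset_iff.2 E.prob_mem_stdSimplex)
    (by rintro _ ⟨ρ, rfl⟩ _ ⟨σ, rfl⟩; exact (hfin ρ σ).1)
    (B := B) (by rintro _ ⟨ρ, rfl⟩ _ ⟨σ, rfl⟩; exact (hfin ρ σ).2)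
  have hlim := (tendsto_exp_neg_natCast_mul (sub_pos.2 hx2)).add
    (tendsto_exp_neg_natCast_mul (mul_pos ht (sub_pos.2 hB2)))
  rw [add_zero] at hlim
  filter_upwards [hlim.eventually_lt_const (sub_pos.2 hε)] with n hn
  rintro _ ⟨τ, υ, a, rfl⟩ hα
  have h1 := sum_seqProd_le_exp_mul_add (R := fun s h => E.prob (τ s h))
    (P := fun s h => E.prob (υ s h)) (fun s h => (E.prob_mem_stdSimplex _).1)
    (fun s h => (E.prob_mem_stdSimplex _).1) (fun s h => (hfin _ _).1) ht
    (fun s h => hmom _ ⟨_, rfl⟩ _ ⟨_, rfl⟩) x a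
  have h2 : ∑ k, seqProd (fun s h => E.prob (τ s h)) k = 1 :=
    sum_seqProd_eq_one fun s h => (E.prob_mem_stdSimplex _).2
  rw [← Finset.sum_add_sum_compl a] at h2
  change ∑ k ∈ aᶜ, seqProd (fun s h => E.prob (τ s h)) k ≤ ε at hα
  change _ ≤ ∑ k ∈ a, seqProd (fun s h => E.prob (υ s h)) k
  -- With β < e^{-ny}, the null probability of a is at most two vanishing terms, although it is at
  -- least 1 - ε.
  by_contra! h3
  have h4 : Real.exp (n * x) * ∑ k ∈ a, seqProd (fun s h => E.prob (υ s h)) k ≤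
      Real.exp (-(n * (y - x))) := by
    refine (mul_le_mul_of_nonneg_left h3.le (Real.exp_pos _).le).trans_eq ?_
    rw [← Real.exp_add]
    ring_nf
  linarith

theorem eventually_le_of_hoeffding_le (E : POVM d m) {r : ℝ} {ζ : EReal}
    (hr : ∀ ρ σ, Real.exp (-r) < supportMass (E.prob ρ) (E.prob σ))
    (hζ : ∀ ρ σ, hoeffding r (E.prob ρ) (E.prob σ) ≤ ζ) {y : ℝ} (hy : ζ < y) :
    ∀ᶠ n : ℕ in atTop, ∀ e ∈ E.adaptiveErrors n, e.1 ≤ Real.exp (-(n * r)) →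
      Real.exp (-(n * y)) ≤ e.2 := by
  obtain ⟨x, hx1, hx2⟩ := EReal.lt_iff_exists_real_btwn.1 hy
  obtain ⟨B, hB1, hB2⟩ := EReal.lt_iff_exists_real_btwn.1 hx1
  obtain ⟨h, hh1, hh2⟩ := EReal.lt_iff_exists_real_btwn.1 hB1
  rw [EReal.coe_lt_coe_iff] at hx2 hB2 hh2
  have hnonneg : ∀ ρ k, 0 ≤ E.prob ρ k := fun ρ => (E.prob_mem_stdSimplex ρ).1
  obtain ⟨t, ht, A, hA, hmom⟩ := exists_intermediate_moment_le_exp E.isCompact_range_prob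
    (Set.range_subset_iff.2 E.prob_mem_stdSimplex) (A := r) (B := B) (by
      rintro _ ⟨ρ, rfl⟩ _ ⟨σ, rfl⟩
      exact exists_kl_lt_of_hoeffding_le (hnonneg ρ) (hnonneg σ) (hr ρ σ)
        ((hζ ρ σ).trans hh1.le) hh2)
  -- The threshold x in (B, y) serves the comparison with the alternative, z in (A, r) that with the
  -- null; the exponents y - x, t(x - B), r - z and t(z - A) are all positive.
  obtain ⟨z, hz1, hz2⟩ := exists_between hA
  have hlim := ((tendsto_exp_neg_natCast_mul (sub_pos.2 hx2)).add
    (tendsto_exp_neg_natCast_mul (mul_pos ht (sub_pos.2 hB2)))).add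
    ((tendsto_exp_neg_natCast_mul (sub_pos.2 hz2)).add
    (tendsto_exp_neg_natCast_mul (mul_pos ht (sub_pos.2 hz1))))
  simp only [add_zero] at hlim
  filter_upwards [hlim.eventually_lt_const one_pos] with n hn
  rintro _ ⟨τ, υ, a, rfl⟩ hα
  have hex := fun (s : Fin n) (h : Fin s → Fin m) =>
    hmom (E.prob (τ s h)) ⟨_, rfl⟩ (E.prob (υ s h)) ⟨_, rfl⟩
  -- One intermediate distribution for each history: together they form a third adaptive law,
  -- compared with both hypotheses.
  choose R hR hRP hRQ hmP hmQ using hex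
  have h1 := sum_seqProd_le_exp_mul_add (fun s h => (hR s h).1)
    (fun s h => hnonneg (υ s h)) hRQ ht hmQ x a
  have h2 := sum_seqProd_le_exp_mul_add (fun s h => (hR s h).1)
    (fun s h => hnonneg (τ s h)) hRP ht hmP z aᶜ
  have h3 : ∑ k, seqProd R k = 1 := sum_seqProd_eq_one fun s h => (hR s h).2
  rw [← Finset.sum_add_sum_compl a] at h3
  change ∑ k ∈ aᶜ, seqProd (fun s h => E.prob (τ s h)) k ≤ _ at hα
  change _ ≤ ∑ k ∈ a, seqProd (fun s h => E.prob (υ s h)) k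
  by_contra! h4
  have h5 : Real.exp (n * x) * ∑ k ∈ a, seqProd (fun s h => E.prob (υ s h)) k ≤
      Real.exp (-(n * (y - x))) := by
    refine (mul_le_mul_of_nonneg_left h4.le (Real.exp_pos _).le).trans_eq ?_
    rw [← Real.exp_add]
    ring_nf
  have h6 : Real.exp (n * z) * ∑ k ∈ aᶜ, seqProd (fun s h => E.prob (τ s h)) k ≤
      Real.exp (-(n * (r - z))) := by
    refine (mul_le_mul_of_nonneg_left hα (Real.exp_pos _).le).trans_eq ?_
    rw [← Real.exp_add]
    ring_nf
  linarith

end Converse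

/-! ### The Hoeffding maximum and the assembly of the theorem -/

theorem POVM.exists_isGreatest_hoeffding {d m : ℕ} (hd : 0 < d) (E : POVM d m) {r : ℝ}
    (hr : ∀ ρ σ, Real.exp (-r) < supportMass (E.prob ρ) (E.prob σ)) :
    ∃ ρ σ, ∀ ρ' σ', hoeffding r (E.prob ρ') (E.prob σ') ≤ hoeffding r (E.prob ρ) (E.prob σ) := by
  obtain ⟨τ⟩ := nonempty_densityMatrix hd
  have hne : (Set.range E.prob).Nonempty := ⟨_, τ, rfl⟩
  have hrange : ∀ P ∈ Set.range E.prob, ∀ Q ∈ Set.range E.prob,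
      Real.exp (-r) < supportMass P Q := by
    rintro _ ⟨ρ, rfl⟩ _ ⟨σ, rfl⟩
    exact hr ρ σ
  have husc := upperSemicontinuousOn_hoeffding
    (Set.range_subset_iff.2 E.prob_mem_stdSimplex) hrange
  obtain ⟨x, ⟨⟨ρ, hρ⟩, ⟨σ, hσ⟩⟩, hmax⟩ := husc.exists_isMaxOn (hne.prod hne)
    (E.isCompact_range_prob.prod E.isCompact_range_prob)
  refine ⟨ρ, σ, fun ρ' σ' => ?_⟩
  rw [hρ, hσ]
  exact isMaxOn_iff.1 hmax (E.prob ρ', E.prob σ') (Set.mk_mem_prod ⟨ρ', rfl⟩ ⟨σ', rfl⟩)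

end DualDiscrimination

theorem mainTheorem2 {d m : ℕ} (hd : 0 < d) (E : DualDiscrimination.POVM d m) :
    (∀ ε : ℝ, 0 < ε → ε < 1 →
      ∃ ζ : EReal,
        IsGreatest (Set.range fun x : DualDiscrimination.DensityMatrix (Fin d) ×
            DualDiscrimination.DensityMatrix (Fin d) =>
          DualDiscrimination.relEntropy (E.prob x.1) (E.prob x.2)) ζ ∧
        DualDiscrimination.IsOptimalExponent E.blockErrors (fun _ => ε) ζ ∧
        DualDiscrimination.IsOptimalExponent E.adaptiveErrors (fun _ => ε) ζ ∧
        ∀ ρ σ : DualDiscrimination.DensityMatrix (Fin d),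
          DualDiscrimination.relEntropy (E.prob ρ) (E.prob σ) = ζ →
          DualDiscrimination.IsOptimalExponent (E.iidErrors ρ σ) (fun _ => ε) ζ) ∧
    (∀ r : ℝ, 0 < r →
      ¬ IsLeast (Set.range fun x : DualDiscrimination.DensityMatrix (Fin d) ×
            DualDiscrimination.DensityMatrix (Fin d) =>
          DualDiscrimination.supportMass (E.prob x.1) (E.prob x.2)) (Real.exp (-r)) →
      ∃ ζ : EReal,
        IsGreatest (Set.range fun x : DualDiscrimination.DensityMatrix (Fin d) ×
            DualDiscrimination.DensityMatrix (Fin d) =>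
          DualDiscrimination.hoeffding r (E.prob x.1) (E.prob x.2)) ζ ∧
        DualDiscrimination.IsOptimalExponent E.blockErrors
          (fun n => Real.exp (-(n * r))) ζ ∧
        DualDiscrimination.IsOptimalExponent E.adaptiveErrors
          (fun n => Real.exp (-(n * r))) ζ ∧
        ∀ ρ σ : DualDiscrimination.DensityMatrix (Fin d),
          DualDiscrimination.hoeffding r (E.prob ρ) (E.prob σ) = ζ →
          DualDiscrimination.IsOptimalExponent (E.iidErrors ρ σ)
            (fun n => Real.exp (-(n * r))) ζ) := by
  open DualDiscrimination in
  have hnonneg : ∀ ρ k, 0 ≤ E.prob ρ k := fun ρ => (E.prob_mem_stdSimplex ρ).1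
  have hgreatest : ∀ (D : DensityMatrix (Fin d) → DensityMatrix (Fin d) → EReal) (ρ σ),
      (∀ ρ' σ', D ρ' σ' ≤ D ρ σ) →
      IsGreatest (Set.range fun x : DensityMatrix (Fin d) × DensityMatrix (Fin d) =>
        D x.1 x.2) (D ρ σ) := fun D ρ σ h =>
    ⟨⟨(ρ, σ), rfl⟩, by rintro _ ⟨x, rfl⟩; exact h x.1 x.2⟩
  refine ⟨fun ε hε0 hε1 => ?_, fun r _ hcrit => ?_⟩
  · obtain ⟨τ⟩ := nonempty_densityMatrix hd
    obtain ⟨_, ⟨ρ, rfl⟩, _, ⟨σ, rfl⟩, hmax⟩ :=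
      exists_isMaxOn_relEntropy E.isCompact_range_prob ⟨_, τ, rfl⟩
    have hmax' : ∀ ρ' σ', relEntropy (E.prob ρ') (E.prob σ') ≤
        relEntropy (E.prob ρ) (E.prob σ) := fun ρ' σ' => hmax _ ⟨ρ', rfl⟩ _ ⟨σ', rfl⟩
    exact ⟨_, hgreatest (fun ρ σ => relEntropy (E.prob ρ) (E.prob σ)) ρ σ hmax',
      E.isOptimalExponent_of_iid hd (D := fun ρ σ => relEntropy (E.prob ρ) (E.prob σ))
        (fun _ => hε0.le) ⟨ρ, σ, rfl⟩
        (fun ρ σ y hy => eventually_exists_test_of_lt_relEntropy (E.prob_mem_stdSimplex ρ)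
          (hnonneg σ) hε0 hy)
        fun y hy => eventually_le_of_relEntropy_le E hε1 hmax' hy⟩
  · suffices hsol : ∃ ρ σ, (∀ ρ' σ', hoeffding r (E.prob ρ') (E.prob σ') ≤
        hoeffding r (E.prob ρ) (E.prob σ)) ∧
        ∀ y : ℝ, hoeffding r (E.prob ρ) (E.prob σ) < y → ∀ᶠ n : ℕ in Filter.atTop,
          ∀ e ∈ E.adaptiveErrors n, e.1 ≤ Real.exp (-(n * r)) →
            Real.exp (-(n * y)) ≤ e.2 by
      obtain ⟨ρ, σ, hmax, hconv⟩ := hsol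
      exact ⟨_, hgreatest (fun ρ σ => hoeffding r (E.prob ρ) (E.prob σ)) ρ σ hmax,
        E.isOptimalExponent_of_iid hd (D := fun ρ σ => hoeffding r (E.prob ρ) (E.prob σ))
          (fun _ => (Real.exp_pos _).le) ⟨ρ, σ, rfl⟩
          (fun ρ σ y hy => Filter.Eventually.of_forall
            (exists_test_of_lt_hoeffding (hnonneg ρ) (hnonneg σ) hy)) hconv⟩
    by_cases hr : ∀ ρ σ, Real.exp (-r) < supportMass (E.prob ρ) (E.prob σ)
    · obtain ⟨ρ, σ, hmax⟩ := E.exists_isGreatest_hoeffding hd hr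
      exact ⟨ρ, σ, hmax, fun y hy => eventually_le_of_hoeffding_le E hr hmax hy⟩
    -- If no support mass were below e^{-r}, the pair with mass at most e^{-r} would attain it as
    -- the minimum, which is the excluded critical rate.
    · have hlt : ∃ ρ σ, supportMass (E.prob ρ) (E.prob σ) < Real.exp (-r) := by
        by_contra! hge
        push Not at hr
        obtain ⟨ρ, σ, hle⟩ := hr
        refine hcrit ⟨⟨(ρ, σ), hle.antisymm (hge ρ σ)⟩, ?_⟩
        rintro _ ⟨x, rfl⟩
        exact hge x.1 x.2
      obtain ⟨ρ, σ, hlt⟩ := hlt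
      have htop := hoeffding_eq_top_of_supportMass_lt (hnonneg ρ) (hnonneg σ) hlt
      -- The maximum is +∞, so the converse is vacuous.
      refine ⟨ρ, σ, fun ρ' σ' => htop ▸ le_top, fun y hy => ?_⟩
      rw [htop] at hy
      exact absurd hy not_top_lt
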